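/- Let $N\ge 1$, let $r_1>r_2>\dots>r_N>0$, and let $D_0=\{x\in\mathbb R^3:|x|>r_1\}$, $D_j=\{r_{j+1}<|x|\le r_j\}$ for $1\le j\le N-1$, and $D_N=\{|x|\le r_N\}$. Let $\lambda,\mu\in\mathbb R$ with $\mu>0$ and $3\lambda+2\mu>0$; let $\varepsilon_0>0$ and let $\varepsilon_1,\dots,\varepsilon_N\in\mathbb C$ with $\operatorname{Im}\varepsilon_j\ge 0$ and $\varepsilon_{j}\neq\varepsilon_{j-1}$ for $1\le j\le N$. Put $\varepsilon(x)=\varepsilon_j$ for $x\in D_j$, $0\le j\le N$, and $(\tilde\lambda,\tilde\mu)=\varepsilon(x)(\lambda,\mu)$. Let $a_0\in\mathbb C$ and let the background field be $H=a_0\mathcal N_1^0$, where $\mathcal N_1^0(x)=\frac{2\mu}{3\lambda+5\mu}\,\frac{1}{\sqrt{4\pi}}\,x$. Consider the Lamé transmission problem $$\nabla\cdot\bigl(\tilde\lambda(\nabla\cdot u)I+2\tilde\mu\nabla^s u\bigr)=0\ \text{ in }\mathbb R^3,\qquad u-H=O(|x|^{-2})\ \text{ as }|x|\to\infty, \qquad(\ast)$$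 for $u\in H^1_{loc}(\mathbb R^3)^3$ with values in $\mathbb C^3$, where $\nabla^s u=\frac12(\nabla u+\nabla u^T)$ and the equation is understood weakly, i.e. $\int_{\mathbb R^3}\bigl(\tilde\lambda(\nabla\cdot u)(\nabla\cdot\varphi)+2\tilde\mu\nabla^su:\nabla^s\varphi\bigr)\,dx=0$ for all $\varphi\in C_c^\infty(\mathbb R^3)^3$ with values in $\mathbb C^3$. Set $\xi=\frac{4\mu}{3\lambda+2\mu}$ and $\beta_j=\frac{\xi\varepsilon_{j-1}+\varepsilon_j}{\varepsilon_{j-1}-\varepsilon_j}$ for $1\le j\le N$. Let the elastic momentum matrix $\mathbb P_N$ be the $N\times N$ matrix with entries $(\mathbb P_N)_{jj}=\beta_j$, $(\mathbb P_N)_{ij}=-1$ for $i<j$, and $(\mathbb P_N)_{ij}=\xi(r_i/r_j)^3$ for $i>j$. Let $\Upsilon_N=\operatorname{diag}(r_1^3,\dots,r_N^3)$ and $e=(1,\dots,1)^T\in\mathbb C^N$. If $\mathbb P_N$ is invertible, then $(\ast)$ has exactly one solution $u$ of the form $$u=(a_j+b_j|x|^{-3})\,\mathcal N_1^0\quad\text{in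 }D_j,\qquad 0\le j\le N,$$ with $a_1,\dots,a_N,b_0,\dots,b_{N-1}\in\mathbb C$, with the given $a_0$, and with $b_N=0$. Outside the structure, for $|x|>r_1$, it satisfies $$u-H=|x|^{-3}\,\bigl(e^T\,\Upsilon_N\,(\mathbb P_N^T)^{-1}e\bigr)\,H.$$ If moreover $\varepsilon_j\ne0$ for all $1\le j\le N$, then every solution of $(\ast)$ that is spherically symmetric, i.e. $v(x)=f(|x|)\,x$ for almost every $x$ with some function $f:(0,\infty)\to\mathbb C$, coincides with $u$ almost everywhere. -/

import Mathlib

open MeasureTheory Filter Asymptotics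
open scoped ContDiff Matrix

noncomputable section

namespace LameLayers

/-- Physical space `ℝ³`. -/
abbrev Space : Type := EuclideanSpace ℝ (Fin 3)

/-- Displacement vectors, `ℂ³`. -/
abbrev Displacement : Type := EuclideanSpace ℂ (Fin 3)

/-- The layers `D_0 = {|x| > r_1}`, `D_j = {r_{j+1} < |x| ≤ r_j}` for `1 ≤ j ≤ N - 1`, and
`D_N = {|x| ≤ r_N}`. Only the values `r 1, …, r N` are used. -/
def layer (N : ℕ) (r : ℕ → ℝ) (j : ℕ) : Set Space :=
  if j = 0 then {x | r 1 < ‖x‖}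
  else if j < N then {x | r (j + 1) < ‖x‖ ∧ ‖x‖ ≤ r j}
  else {x | ‖x‖ ≤ r N}

/-- The piecewise constant coefficient `ε(x) = ∑_{j=0}^N ε_j χ_{D_j}(x)`. -/
def coeff (N : ℕ) (r : ℕ → ℝ) (ε : ℕ → ℂ) (x : Space) : ℂ :=
  ∑ j ∈ Finset.range (N + 1), (layer N r j).indicator (fun _ => ε j) x

/-- The `j`-th standard basis vector of `ℝ³`. -/
def basisVec (j : Fin 3) : Space := EuclideanSpace.single j 1

/-- The classical Jacobian `(∂_j φ_i)_{ij}` of a (smooth) field. -/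
def jacobian (φ : Space → Displacement) (x : Space) : Matrix (Fin 3) (Fin 3) ℂ :=
  Matrix.of fun i j => (fderiv ℝ φ x (basisVec j)) i

/-- `u ∈ H¹_loc(ℝ³)³` and the matrix field `G` is its weak gradient, `G_{ij} = ∂_j u_i`. -/
structure HasWeakGradientH1Loc (u : Space → Displacement)
    (G : Space → Matrix (Fin 3) (Fin 3) ℂ) : Prop where
  memLp_field : ∀ K : Set Space, IsCompact K → ∀ i,
    MemLp (fun x => u x i) 2 (volume.restrict K)
  memLp_grad : ∀ K : Set Space, IsCompact K → ∀ i j,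
    MemLp (fun x => G x i j) 2 (volume.restrict K)
  weak_deriv : ∀ ψ : Space → ℂ, ContDiff ℝ ∞ ψ → HasCompactSupport ψ → ∀ i j,
    ∫ x, u x i * fderiv ℝ ψ x (basisVec j) = - ∫ x, G x i j * ψ x

/-- The strain (symmetric part) `½ (A + Aᵀ)` of a displacement gradient `A`. -/
def strain (A : Matrix (Fin 3) (Fin 3) ℂ) : Matrix (Fin 3) (Fin 3) ℂ :=
  (1 / 2 : ℂ) • (A + Aᵀ)

/-- The elastic energy density `∇ˢv : C_{l,m} ∇ˢu = l (∇·u)(∇·v) + 2m ∇ˢu : ∇ˢv` for the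
moduli `l`, `m`, as a function of the gradients `A = ∇u` and `B = ∇v`. It is bilinear, without
complex conjugation. -/
def energyDensity (l m : ℂ) (A B : Matrix (Fin 3) (Fin 3) ℂ) : ℂ :=
  l * (A.trace * B.trace) + 2 * m * ∑ i, ∑ j, strain A i j * strain B i j

/-- `u ∈ H¹_loc(ℝ³)³` solves `∇ · C ∇ˢu = 0` in `ℝ³` in the weak sense, with the moduli
`ε(x) (lam, mu)` of the layered structure, and `u - H = O(|x|⁻²)` at infinity. The transmission
conditions on the interfaces are contained in the weak formulation on all of `ℝ³`. -/
def IsLameSolution (N : ℕ) (r : ℕ → ℝ) (lam mu : ℝ) (ε : ℕ → ℂ) (H u : Space → Displacement) :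
    Prop :=
  (∃ G : Space → Matrix (Fin 3) (Fin 3) ℂ, HasWeakGradientH1Loc u G ∧
    ∀ φ : Space → Displacement, ContDiff ℝ ∞ φ → HasCompactSupport φ →
      ∫ x, energyDensity (coeff N r ε x * lam) (coeff N r ε x * mu) (G x) (jacobian φ x) = 0) ∧
  (fun x => u x - H x) =O[cocompact Space] fun x => (‖x‖ ^ 2)⁻¹

/-- The vector polynomial `𝒩₁⁰ = γ₁⁰ Y₀⁰ x + (1 - γ₁⁰ - r²) ∇Y₀⁰ = γ₁⁰ Y₀⁰ x`, where
`γ₁⁰ = 2μ / (3λ + 5μ)` and `Y₀⁰ = 1 / √(4π)` is the constant spherical harmonic. -/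
def uniformMode (lam mu : ℝ) (x : Space) : Displacement :=
  WithLp.toLp 2 fun i =>
    (((2 * mu / (3 * lam + 5 * mu)) * (1 / Real.sqrt (4 * Real.pi)) * x i : ℝ) : ℂ)

/-- The background field `H = a₀ 𝒩₁⁰`. -/
def background (lam mu : ℝ) (a₀ : ℂ) (x : Space) : Displacement :=
  a₀ • uniformMode lam mu x

/-- The layered form: `u = a_j 𝒩₁⁰ + r⁻³ b_j 𝒩₁⁰` in `D_j` for `0 ≤ j ≤ N`, with the given
`a₀` in the exterior and `b_N = 0` in the core. -/
def HasLayeredForm (N : ℕ) (r : ℕ → ℝ) (lam mu : ℝ) (a₀ : ℂ) (u : Space → Displacement) : Prop :=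
  ∃ a b : ℕ → ℂ, a 0 = a₀ ∧ b N = 0 ∧
    ∀ j ≤ N, ∀ x ∈ layer N r j,
      u x = (a j + b j * (((‖x‖ ^ 3)⁻¹ : ℝ) : ℂ)) • uniformMode lam mu x

/-- `u(x) = f(|x|) x` for almost every `x`. -/
def IsSphericallySymmetric (u : Space → Displacement) : Prop :=
  ∃ f : ℝ → ℂ, ∀ᵐ x : Space, ∀ i, u x i = f ‖x‖ * (x i : ℂ)

/-- The constant `ξ = 4μ / (3λ + 2μ)`. -/
def xi (lam mu : ℝ) : ℝ := 4 * mu / (3 * lam + 2 * mu)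

/-- `β_j = (ξ ε_{j-1} + ε_j) / (ε_{j-1} - ε_j)`, for `1 ≤ j`. -/
def beta (lam mu : ℝ) (ε : ℕ → ℂ) (j : ℕ) : ℂ :=
  (xi lam mu * ε (j - 1) + ε j) / (ε (j - 1) - ε j)

/-- The elastic momentum matrix `ℙ_N`. The index `i : Fin N` stands for the number `i + 1`. -/
def momentumMatrix (N : ℕ) (r : ℕ → ℝ) (lam mu : ℝ) (ε : ℕ → ℂ) : Matrix (Fin N) (Fin N) ℂ :=
  Matrix.of fun i j =>
    if i = j then beta lam mu ε (i + 1)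
    else if i < j then -1
    else ((xi lam mu * (r (i + 1) / r (j + 1)) ^ 3 : ℝ) : ℂ)

/-- `Υ_N = diag(r_1³, …, r_N³)`. -/
def upsilon (N : ℕ) (r : ℕ → ℝ) : Matrix (Fin N) (Fin N) ℂ :=
  Matrix.diagonal fun i => ((r (i + 1) ^ 3 : ℝ) : ℂ)

/-- The vector `e = (1, …, 1)ᵀ`. -/
def onesVec (N : ℕ) : Fin N → ℂ := fun _ => 1

end LameLayers

end

/-! ### Smooth test fields and their Jacobians. -/

noncomputable section

namespace LameLayers

/-! Up to the constant factor in 𝒩₁⁰, the two radial modes are x and x/|x|³. Their gradients, I and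
`coulombGrad`, are symmetric, and the second is trace free. Both modes solve the Lamé equation in
each layer, so everything is decided at the interfaces. H¹_loc forces the field to be continuous
there (`fieldDefect` vanishes), and the weak equation forces the traction to be continuous
(`tractionDefect` vanishes).

Continuous layered fields are exactly the superpositions a₀ x + Σ p_i min(1, (r_{i+1}/|x|)³) x. The
natural unknowns are therefore the jumps p_i of the linear coefficient: a_j - a₀ and b_j are partial
sums of p_i and of p_i r_{i+1}³. In these unknowns the traction conditions, divided by (3λ+2μ)(ε_j -
ε_{j+1}), become ℙᵀ p = a₀ e (`forall_tractionDefect_eq_zero_iff`), and the exterior coefficient is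
b₀ = eᵀ Υ p.

No surface integrals are needed. Second derivatives commute, hence ∫ tr(∇u ∇φ) = ∫ (∇·u)(∇·φ)
(`integral_sum_mul_eq_integral_trace_mul_trace`). This reduces the weak form of a layered field to Σ
tractionDefect_i ∫_{|x| ≤ r_{i+1}} ∇·φ (`integral_energyDensity_layered`). Vanishing defects thus
give a solution; conversely, a radial test field concentrated at one interface isolates one defect.
A similar test shows that a jump of the field would put surface mass into its weak divergence
(`fieldDefect_eq_zero`).

For a spherically symmetric v = f(|x|) x, the same identity and radial φ give ∫ (∇·v)(∇·φ) = 0 in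
every layer with ε_j ≠ 0. This is an ordinary differential equation for ρ³ f with solutions Aρ³ + B
(`ae_eq_cubic_of_integral_deriv`). Decay at infinity fixes the exterior A, square integrability at
the origin kills the core B, and v falls under the uniqueness of layered solutions. -/

theorem locallyIntegrable_of_memLp_two {g : Space → ℂ}
    (hg : ∀ K : Set Space, IsCompact K → MemLp g 2 (volume.restrict K)) :
    LocallyIntegrable g := by
  rw [locallyIntegrable_iff]
  intro K hK
  have : IsFiniteMeasure (volume.restrict K) := ⟨by simpa using hK.measure_lt_top⟩
  exact (hg K hK).integrable (by norm_num)

theorem integrable_mul_of_hasCompactSupport {g ψ : Space → ℂ} (hg : LocallyIntegrable g)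
    (hψ : Continuous ψ) (hc : HasCompactSupport ψ) : Integrable fun x => g x * ψ x := by
  simpa [mul_comm] using hg.integrable_smul_left_of_hasCompactSupport hψ hc

theorem contDiff_fderiv_apply {E F : Type*} [NormedAddCommGroup E] [NormedSpace ℝ E]
    [NormedAddCommGroup F] [NormedSpace ℝ F] {ψ : E → F} (hψ : ContDiff ℝ ∞ ψ) (v : E) :
    ContDiff ℝ ∞ fun x => fderiv ℝ ψ x v :=
  (hψ.fderiv_right (m := ∞) (by simp)).clm_apply contDiff_const

theorem contDiff_component {E : Type*} [NormedAddCommGroup E] [NormedSpace ℝ E]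
    {φ : E → Displacement} (hφ : ContDiff ℝ ∞ φ) (i : Fin 3) :
    ContDiff ℝ ∞ fun x => φ x i :=
  ((EuclideanSpace.proj (𝕜 := ℂ) i).restrictScalars ℝ).contDiff.comp hφ

theorem hasCompactSupport_component {E : Type*} [TopologicalSpace E]
    {φ : E → Displacement} (hφ : HasCompactSupport φ) (i : Fin 3) :
    HasCompactSupport fun x => φ x i :=
  hφ.comp_left (g := fun y : Displacement => y i) rfl

theorem jacobian_apply_eq_fderiv_component {φ : Space → Displacement} (hφ : ContDiff ℝ ∞ φ)
    (x : Space) (i j : Fin 3) :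
    jacobian φ x i j = fderiv ℝ (fun y => φ y i) x (basisVec j) := by
  have h : HasFDerivAt (fun y => φ y i)
      (((EuclideanSpace.proj (𝕜 := ℂ) i).restrictScalars ℝ).comp (fderiv ℝ φ x)) x :=
    (((EuclideanSpace.proj (𝕜 := ℂ) i).restrictScalars ℝ).hasFDerivAt).comp x
      ((hφ.differentiable (by simp)) x).hasFDerivAt
  rw [h.fderiv]
  rfl

theorem contDiff_jacobian {φ : Space → Displacement} (hφ : ContDiff ℝ ∞ φ) (i j : Fin 3) :
    ContDiff ℝ ∞ fun x => jacobian φ x i j := by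
  simp only [jacobian_apply_eq_fderiv_component hφ]
  exact contDiff_fderiv_apply (contDiff_component hφ i) _

theorem hasCompactSupport_jacobian {φ : Space → Displacement} (hφ : ContDiff ℝ ∞ φ)
    (hc : HasCompactSupport φ) (i j : Fin 3) :
    HasCompactSupport fun x => jacobian φ x i j := by
  simp only [jacobian_apply_eq_fderiv_component hφ]
  exact (hasCompactSupport_component hc i).fderiv_apply ℝ _

/-- Symmetry of the second derivative of a component; this is the only analytic input of the null
Lagrangian identity. -/
theorem fderiv_jacobian_comm {φ : Space → Displacement} (hφ : ContDiff ℝ ∞ φ)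
    (x : Space) (i j k : Fin 3) :
    fderiv ℝ (fun y => jacobian φ y i j) x (basisVec k) =
      fderiv ℝ (fun y => jacobian φ y i k) x (basisVec j) := by
  simp only [jacobian_apply_eq_fderiv_component hφ]
  have hc := contDiff_component hφ i
  have hd : DifferentiableAt ℝ (fderiv ℝ fun y => φ y i) x :=
    ((hc.fderiv_right (m := ∞) (by simp)).differentiable (by simp)) x
  rw [fderiv_clm_apply hd (by fun_prop), fderiv_clm_apply hd (by fun_prop)]
  simpa using (hc.contDiffAt (x := x)).isSymmSndFDerivAt (by
      simpa using WithTop.coe_le_coe.2 (le_top : (2 : ℕ∞) ≤ ⊤))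
    (basisVec k) (basisVec j)

/-! ### Calculus of weak gradients and the null Lagrangian identity. -/

namespace HasWeakGradientH1Loc

variable {u v : Space → Displacement} {G G' : Space → Matrix (Fin 3) (Fin 3) ℂ}

theorem locallyIntegrable_field (h : HasWeakGradientH1Loc u G) (i : Fin 3) :
    LocallyIntegrable fun x => u x i :=
  locallyIntegrable_of_memLp_two fun K hK => h.memLp_field K hK i

theorem locallyIntegrable_grad (h : HasWeakGradientH1Loc u G) (i j : Fin 3) :
    LocallyIntegrable fun x => G x i j :=
  locallyIntegrable_of_memLp_two fun K hK => h.memLp_grad K hK i j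

theorem add (h : HasWeakGradientH1Loc u G) (h' : HasWeakGradientH1Loc v G') :
    HasWeakGradientH1Loc (u + v) (G + G') where
  memLp_field K hK i := (h.memLp_field K hK i).add (h'.memLp_field K hK i)
  memLp_grad K hK i j := (h.memLp_grad K hK i j).add (h'.memLp_grad K hK i j)
  weak_deriv ψ hψ hc i j := by
    have hd := (contDiff_fderiv_apply hψ (basisVec j)).continuous
    have hdc : HasCompactSupport fun x => fderiv ℝ ψ x (basisVec j) := hc.fderiv_apply ℝ _
    simp only [Pi.add_apply, PiLp.add_apply, Matrix.add_apply, add_mul]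
    rw [integral_add, integral_add, h.weak_deriv ψ hψ hc, h'.weak_deriv ψ hψ hc, neg_add]
    · exact integrable_mul_of_hasCompactSupport (h.locallyIntegrable_grad i j) hψ.continuous hc
    · exact integrable_mul_of_hasCompactSupport (h'.locallyIntegrable_grad i j) hψ.continuous hc
    · exact integrable_mul_of_hasCompactSupport (h.locallyIntegrable_field i) hd hdc
    · exact integrable_mul_of_hasCompactSupport (h'.locallyIntegrable_field i) hd hdc

theorem const_smul (h : HasWeakGradientH1Loc u G) (c : ℂ) :
    HasWeakGradientH1Loc (c • u) (c • G) where
  memLp_field K hK i := (h.memLp_field K hK i).const_mul c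
  memLp_grad K hK i j := (h.memLp_grad K hK i j).const_mul c
  weak_deriv ψ hψ hc i j := by
    simp only [Pi.smul_apply, PiLp.smul_apply, Matrix.smul_apply, smul_eq_mul, mul_assoc]
    rw [integral_const_mul, integral_const_mul, h.weak_deriv ψ hψ hc, mul_neg]

theorem zero : HasWeakGradientH1Loc 0 0 where
  memLp_field K hK i := by simp
  memLp_grad K hK i j := by simp
  weak_deriv ψ hψ hc i j := by simp

theorem sum {ι : Type*} (s : Finset ι) {u : ι → Space → Displacement}
    {G : ι → Space → Matrix (Fin 3) (Fin 3) ℂ} (h : ∀ i ∈ s, HasWeakGradientH1Loc (u i) (G i)) :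
    HasWeakGradientH1Loc (∑ i ∈ s, u i) (∑ i ∈ s, G i) := by
  classical
  induction s using Finset.induction_on with
  | empty => simpa using zero
  | insert i s hi ih =>
    rw [Finset.sum_insert hi, Finset.sum_insert hi]
    exact (h i (by simp)).add (ih fun k hk => h k (by simp [hk]))

theorem sub (h : HasWeakGradientH1Loc u G) (h' : HasWeakGradientH1Loc v G') :
    HasWeakGradientH1Loc (u - v) (G - G') := by
  simpa [sub_eq_add_neg] using h.add (h'.const_smul (-1))

theorem congr_field (h : HasWeakGradientH1Loc u G) (huv : u =ᵐ[volume] v) :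
    HasWeakGradientH1Loc v G where
  memLp_field K hK i := by
    refine (h.memLp_field K hK i).ae_eq (ae_restrict_of_ae ?_)
    filter_upwards [huv] with x hx using by rw [hx]
  memLp_grad := h.memLp_grad
  weak_deriv ψ hψ hc i j := by
    rw [← h.weak_deriv ψ hψ hc]
    refine integral_congr_ae ?_
    filter_upwards [huv] with x hx using by rw [hx]

/-- The fundamental lemma of the calculus of variations, entry by entry; real test functions, viewed
as complex ones, suffice. -/
theorem ae_unique (h : HasWeakGradientH1Loc u G) (h' : HasWeakGradientH1Loc u G') :
    G =ᵐ[volume] G' := by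
  have key : ∀ i j, ∀ᵐ x, G x i j = G' x i j := by
    intro i j
    refine ae_eq_of_integral_contDiff_smul_eq (h.locallyIntegrable_grad i j)
      (h'.locallyIntegrable_grad i j) fun g hg hc => ?_
    have hgc : ContDiff ℝ ∞ fun x => (g x : ℂ) := Complex.ofRealCLM.contDiff.comp hg
    have hcc : HasCompactSupport fun x => (g x : ℂ) := hc.comp_left (g := fun y : ℝ => (y : ℂ)) rfl
    have := (h.weak_deriv _ hgc hcc i j).symm.trans (h'.weak_deriv _ hgc hcc i j)
    simpa [mul_comm] using this
  have hall : ∀ᵐ x, ∀ i j, G x i j = G' x i j := by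
    simpa only [ae_all_iff] using key
  filter_upwards [hall] with x hx
  ext i j
  exact hx i j

/-- The difference of the two quadratic invariants of the gradient is a null Lagrangian. -/
theorem integral_sum_mul_eq_integral_trace_mul_trace (h : HasWeakGradientH1Loc u G)
    {φ : Space → Displacement} (hφ : ContDiff ℝ ∞ φ) (hc : HasCompactSupport φ) :
    ∫ x, ∑ i, ∑ j, G x i j * jacobian φ x j i = ∫ x, (G x).trace * (jacobian φ x).trace := by
  have hint : ∀ i j k l, Integrable fun x => G x i j * jacobian φ x k l := fun i j k l =>
    integrable_mul_of_hasCompactSupport (h.locallyIntegrable_grad i j)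
      (contDiff_jacobian hφ k l).continuous (hasCompactSupport_jacobian hφ hc k l)
  simp only [Matrix.trace, Matrix.diag, Finset.sum_mul_sum]
  rw [integral_finsetSum _ fun i _ => integrable_finsetSum _ fun j _ => hint i j j i,
    integral_finsetSum _ fun i _ => integrable_finsetSum _ fun j _ => hint i i j j]
  refine Finset.sum_congr rfl fun i _ => ?_
  rw [integral_finsetSum _ fun j _ => hint i j j i, integral_finsetSum _ fun j _ => hint i i j j]
  refine Finset.sum_congr rfl fun j _ => ?_
  have h1 := h.weak_deriv _ (contDiff_jacobian hφ j i) (hasCompactSupport_jacobian hφ hc j i) i j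
  have h2 := h.weak_deriv _ (contDiff_jacobian hφ j j) (hasCompactSupport_jacobian hφ hc j j) i i
  simp only [fderiv_jacobian_comm hφ _ j i j] at h1
  exact neg_injective (h1.symm.trans h2)

/-- A Lipschitz field whose line derivatives are known almost everywhere. -/
theorem of_lipschitz {w : Space → Space} {C : NNReal} (hw : LipschitzWith C w)
    {D : Space → Matrix (Fin 3) (Fin 3) ℝ}
    (hD : ∀ᵐ x, ∀ i j, lineDeriv ℝ (fun y => w y i) x (basisVec j) = D x i j) :
    HasWeakGradientH1Loc (fun x => WithLp.toLp 2 fun i => (w x i : ℂ))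
      (fun x => (D x).map (fun y => (y : ℂ))) := by
  have hwi : ∀ i, LipschitzWith C fun x => w x i := fun i => by
    refine LipschitzWith.of_dist_le_mul fun x y => ?_
    refine le_trans ?_ (hw.dist_le_mul x y)
    rw [dist_eq_norm, dist_eq_norm]
    exact PiLp.norm_apply_le (w x - w y) i
  have hDi : ∀ i j, (fun x => lineDeriv ℝ (fun y => w y i) x (basisVec j)) =ᵐ[volume]
      fun x => D x i j := by
    intro i j
    filter_upwards [hD] with x hx using hx i j
  have hmem : ∀ i j, MemLp (fun x => D x i j) ⊤ volume := fun i j =>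
    ((hwi i).memLp_lineDeriv (basisVec j)).ae_eq (hDi i j)
  refine ⟨fun K hK i => ?_, fun K hK i j => ?_, fun ψ hψ hc i j => ?_⟩
  · have : IsFiniteMeasure (volume.restrict K) := ⟨by simpa using hK.measure_lt_top⟩
    have hcont : Continuous fun x => (w x i : ℂ) :=
      Complex.continuous_ofReal.comp (hwi i).continuous
    obtain ⟨M, hM⟩ := hK.exists_bound_of_continuousOn hcont.continuousOn
    refine MemLp.of_bound hcont.aestronglyMeasurable M ?_
    exact (ae_restrict_iff' hK.measurableSet).2 (.of_forall hM)
  · have : IsFiniteMeasure (volume.restrict K) := ⟨by simpa using hK.measure_lt_top⟩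
    exact (((hmem i j).restrict K).mono_exponent le_top).ofReal
  · have real_case : ∀ g : Space → ℝ, ContDiff ℝ ∞ g → HasCompactSupport g →
        ∫ x, w x i * fderiv ℝ g x (basisVec j) = - ∫ x, D x i j * g x := by
      intro g hg hgc
      obtain ⟨B, hB⟩ := hg.lipschitzWith_of_hasCompactSupport hgc (by simp)
      have := (hwi i).integral_lineDeriv_mul_eq (μ := volume) hB hgc (basisVec j)
      have e1 : ∫ x, D x i j * g x = ∫ x, lineDeriv ℝ (fun y => w y i) x (basisVec j) * g x :=
        integral_congr_ae (by filter_upwards [hDi i j] with x hx using by rw [hx])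
      rw [e1, this, ← integral_neg]
      refine integral_congr_ae (.of_forall fun x => ?_)
      have hl : lineDeriv ℝ g x (-basisVec j) = - fderiv ℝ g x (basisVec j) := by
        rw [((hg.differentiable (by simp)) x).lineDeriv_eq_fderiv, map_neg]
      simp only [hl]
      ring
    have hre : ContDiff ℝ ∞ fun x => (ψ x).re := Complex.reCLM.contDiff.comp hψ
    have him : ContDiff ℝ ∞ fun x => (ψ x).im := Complex.imCLM.contDiff.comp hψ
    have hrec : HasCompactSupport fun x => (ψ x).re := hc.comp_left (g := Complex.re) rfl
    have himc : HasCompactSupport fun x => (ψ x).im := hc.comp_left (g := Complex.im) rfl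
    have dre : ∀ x, fderiv ℝ (fun x => (ψ x).re) x (basisVec j) =
        (fderiv ℝ ψ x (basisVec j)).re := fun x => by
      have := (Complex.reCLM.hasFDerivAt (x := ψ x)).comp x
        ((hψ.differentiable (by simp)) x).hasFDerivAt
      exact congrArg (fun L => L (basisVec j)) this.fderiv
    have dim : ∀ x, fderiv ℝ (fun x => (ψ x).im) x (basisVec j) =
        (fderiv ℝ ψ x (basisVec j)).im := fun x => by
      have := (Complex.imCLM.hasFDerivAt (x := ψ x)).comp x
        ((hψ.differentiable (by simp)) x).hasFDerivAt
      exact congrArg (fun L => L (basisVec j)) this.fderiv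
    have i1 : Integrable fun x => (w x i : ℂ) * fderiv ℝ ψ x (basisVec j) :=
      integrable_mul_of_hasCompactSupport
        (Complex.continuous_ofReal.comp (hwi i).continuous).locallyIntegrable
        (contDiff_fderiv_apply hψ (basisVec j)).continuous (hc.fderiv_apply ℝ _)
    have hDloc : LocallyIntegrable fun x => (D x i j : ℂ) :=
      locallyIntegrable_of_memLp_two fun K hK => by
        have : IsFiniteMeasure (volume.restrict K) := ⟨by simpa using hK.measure_lt_top⟩
        exact (((hmem i j).restrict K).mono_exponent le_top).ofReal
    have i2 : Integrable fun x => (D x i j : ℂ) * ψ x :=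
      integrable_mul_of_hasCompactSupport hDloc hψ.continuous hc
    have r1 := real_case _ hre hrec
    have r2 := real_case _ him himc
    simp only [dre, dim] at r1 r2
    change ∫ x, (w x i : ℂ) * fderiv ℝ ψ x (basisVec j) = - ∫ x, (D x i j : ℂ) * ψ x
    have s1 := integral_re_add_im (𝕜 := ℂ) i1
    have s2 := integral_re_add_im (𝕜 := ℂ) i2
    rw [← s1, ← s2]
    simp only [RCLike.re_to_complex, RCLike.im_to_complex, Complex.re_ofReal_mul,
      Complex.im_ofReal_mul, r1, r2]
    push_cast
    ring

end HasWeakGradientH1Loc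

/-! ### Radial fields and the truncated Coulomb field. -/

/-- The gradient of `η(|x|) x`, as a function of the values `p = η(|x|)` and `q = η'(|x|)`. -/
def radialGrad (p q : ℝ) (x : Space) : Matrix (Fin 3) (Fin 3) ℝ :=
  Matrix.of fun i j => p * (if i = j then 1 else 0) + q * (x i * x j / ‖x‖)

theorem radialGrad_transpose (p q : ℝ) (x : Space) : (radialGrad p q x)ᵀ = radialGrad p q x := by
  ext i j
  simp [radialGrad, eq_comm, mul_comm (x i)]

theorem sum_sq_eq_norm_sq (x : Space) : ∑ i, x i * x i = ‖x‖ ^ 2 := by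
  rw [EuclideanSpace.norm_sq_eq]
  simp [sq]

theorem trace_radialGrad (p q : ℝ) (x : Space) :
    (radialGrad p q x).trace = 3 * p + q * ‖x‖ := by
  have : (radialGrad p q x).trace = 3 * p + q * ((∑ i, x i * x i) / ‖x‖) := by
    simp [radialGrad, Matrix.trace, Fin.sum_univ_three]
    ring
  rw [this, sum_sq_eq_norm_sq]
  rcases eq_or_ne ‖x‖ 0 with h | h
  · simp [h]
  · field_simp

theorem hasFDerivAt_norm_of_ne_zero {x : Space} (hx : x ≠ 0) :
    HasFDerivAt (fun y : Space => ‖y‖) (‖x‖⁻¹ • innerSL ℝ x) x := by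
  have h : HasFDerivAt (fun y : Space => √(‖y‖ ^ 2)) ((1 / (2 * √(‖x‖ ^ 2))) •
      (2 : ℝ) • innerSL ℝ x) x := by
    simpa only [ofNat_smul_eq_nsmul] using
      (hasStrictFDerivAt_norm_sq x).hasFDerivAt.sqrt (by simpa using hx)
  simp only [Real.sqrt_sq (norm_nonneg _)] at h
  rw [smul_smul, show 1 / (2 * ‖x‖) * 2 = ‖x‖⁻¹ by field_simp] at h
  exact h

theorem hasFDerivAt_radial_smul {η : ℝ → ℝ} {d : ℝ} {x : Space} (hx : x ≠ 0)
    (hη : HasDerivAt η d ‖x‖) (i : Fin 3) :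
    ∃ L : Space →L[ℝ] ℝ, HasFDerivAt (fun y : Space => η ‖y‖ * y i) L x ∧
      ∀ j, L (basisVec j) = radialGrad (η ‖x‖) d x i j := by
  have h1 := hη.comp_hasFDerivAt x (hasFDerivAt_norm_of_ne_zero hx)
  have h2 : HasFDerivAt (fun y : Space => y i) (EuclideanSpace.proj i : Space →L[ℝ] ℝ) x :=
    (EuclideanSpace.proj i : Space →L[ℝ] ℝ).hasFDerivAt
  refine ⟨_, h1.mul h2, fun j => ?_⟩
  have hne : ‖x‖ ≠ 0 := by simpa using hx
  simp [radialGrad, basisVec, EuclideanSpace.inner_single_right]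
  field_simp

/-- The field `min(1, (s/|x|)³) x`. -/
def truncField (s : ℝ) (x : Space) : Space := (s / max s ‖x‖) ^ 3 • x

/-- The gradient of `truncField s` off the sphere `|x| = s`. -/
def truncGrad (s : ℝ) (x : Space) : Matrix (Fin 3) (Fin 3) ℝ :=
  if ‖x‖ ≤ s then 1 else radialGrad (s ^ 3 / ‖x‖ ^ 3) (-3 * s ^ 3 / ‖x‖ ^ 4) x

theorem truncField_of_le {s : ℝ} (hs : 0 < s) {x : Space} (hx : ‖x‖ ≤ s) : truncField s x = x := by
  rw [truncField, max_eq_left hx, div_self hs.ne', one_pow, one_smul]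

theorem truncField_of_lt {s : ℝ} {x : Space} (hx : s < ‖x‖) :
    truncField s x = (s ^ 3 / ‖x‖ ^ 3) • x := by
  rw [truncField, max_eq_right hx.le, div_pow]

/-- The constant is 1 + 3: moving the point under a factor k³ ≤ 1 costs 1, and changing the factor
costs 3, because |k³ - l³| ≤ 3 |k - l| for k, l in [0, 1]. -/
theorem lipschitzWith_truncField {s : ℝ} (hs : 0 < s) : LipschitzWith 4 (truncField s) := by
  refine LipschitzWith.of_dist_le_mul fun x y => ?_
  rw [dist_eq_norm, dist_eq_norm]
  set m := max s ‖x‖ with hm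
  set n := max s ‖y‖ with hn
  have hm0 : 0 < m := lt_of_lt_of_le hs (le_max_left _ _)
  have hn0 : 0 < n := lt_of_lt_of_le hs (le_max_left _ _)
  have hyn : ‖y‖ ≤ n := le_max_right _ _
  have hmn : |n - m| ≤ ‖x - y‖ := by
    have h1 : |m - n| ≤ max |s - s| |‖x‖ - ‖y‖| := abs_max_sub_max_le_max _ _ _ _
    rw [abs_sub_comm]
    refine h1.trans (max_le (by simp) (abs_norm_sub_norm_le x y))
  set k := s / m with hk
  set l := s / n with hl
  have hk0 : 0 ≤ k := by positivity
  have hl0 : 0 ≤ l := by positivity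
  have hk1 : k ≤ 1 := (div_le_one hm0).2 (le_max_left _ _)
  have hl1 : l ≤ 1 := (div_le_one hn0).2 (le_max_left _ _)
  -- The factor s / max(s, |x|) varies slowly where |y| is large: (k - l) n = k (n - m), so the
  -- weight n ≥ |y| is absorbed.
  have hkl : |k - l| * n ≤ ‖x - y‖ := by
    have : (k - l) * n = k * (n - m) := by
      rw [hk, hl]; field_simp
    calc |k - l| * n = |(k - l) * n| := by rw [abs_mul, abs_of_pos hn0]
      _ = k * |n - m| := by rw [this, abs_mul, abs_of_nonneg hk0]
      _ ≤ 1 * ‖x - y‖ := by gcongr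
      _ = _ := one_mul _
  have hdecomp : truncField s x - truncField s y = k ^ 3 • (x - y) + (k ^ 3 - l ^ 3) • y := by
    simp only [truncField, ← hm, ← hn, ← hk, ← hl]
    module
  have hcub : |k ^ 3 - l ^ 3| ≤ |k - l| * 3 := by
    have : k ^ 3 - l ^ 3 = (k - l) * (k ^ 2 + k * l + l ^ 2) := by ring
    rw [this, abs_mul]
    gcongr
    rw [abs_of_nonneg (by positivity)]
    nlinarith
  rw [hdecomp]
  calc ‖k ^ 3 • (x - y) + (k ^ 3 - l ^ 3) • y‖
      ≤ ‖k ^ 3 • (x - y)‖ + ‖(k ^ 3 - l ^ 3) • y‖ := norm_add_le _ _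
    _ = k ^ 3 * ‖x - y‖ + |k ^ 3 - l ^ 3| * ‖y‖ := by
        rw [norm_smul, norm_smul, Real.norm_eq_abs, Real.norm_eq_abs,
          abs_of_nonneg (by positivity : 0 ≤ k ^ 3)]
    _ ≤ 1 * ‖x - y‖ + (|k - l| * 3) * n := by
        gcongr
        exact pow_le_one₀ hk0 hk1
    _ ≤ (4 : NNReal) * ‖x - y‖ := by
        push_cast
        linarith

theorem lineDeriv_truncField {s : ℝ} (hs : 0 < s) {x : Space} (hx : ‖x‖ ≠ s) (i j : Fin 3) :
    lineDeriv ℝ (fun y => truncField s y i) x (basisVec j) = truncGrad s x i j := by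
  rcases lt_or_gt_of_ne hx with h | h
  · have hev : (fun y => truncField s y i) =ᶠ[nhds x] fun y => y i := by
      filter_upwards [(isOpen_lt continuous_norm continuous_const).mem_nhds h] with y hy
      rw [truncField_of_le hs (le_of_lt hy)]
    have hd : HasFDerivAt (fun y : Space => y i) (EuclideanSpace.proj i : Space →L[ℝ] ℝ) x :=
      (EuclideanSpace.proj i : Space →L[ℝ] ℝ).hasFDerivAt
    rw [hev.lineDeriv_eq, hd.differentiableAt.lineDeriv_eq_fderiv, hd.fderiv, truncGrad,
      if_pos h.le]
    simp [basisVec, Matrix.one_apply]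
  · have hev : (fun y => truncField s y i) =ᶠ[nhds x] fun y => (s ^ 3 / ‖y‖ ^ 3) * y i := by
      filter_upwards [(isOpen_lt continuous_const continuous_norm).mem_nhds h] with y hy
      rw [truncField_of_lt hy]
      rfl
    have hpos : 0 < ‖x‖ := hs.trans h
    have hη : HasDerivAt (fun ρ : ℝ => s ^ 3 / ρ ^ 3) (-3 * s ^ 3 / ‖x‖ ^ 4) ‖x‖ := by
      have := (hasDerivAt_const ‖x‖ (s ^ 3)).div (hasDerivAt_pow 3 ‖x‖) (by positivity)
      exact this.congr_deriv (by field_simp; ring)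
    obtain ⟨L, hL, hL'⟩ := hasFDerivAt_radial_smul (norm_pos_iff.1 hpos) hη i
    rw [hev.lineDeriv_eq, hL.differentiableAt.lineDeriv_eq_fderiv, hL.fderiv, hL', truncGrad,
      if_neg h.not_ge]

theorem ae_norm_ne {s : ℝ} (hs : 0 < s) : ∀ᵐ x : Space, ‖x‖ ≠ s := by
  have : volume (Metric.sphere (0 : Space) s) = 0 := Measure.addHaar_sphere_of_ne_zero _ _ hs.ne'
  rw [measure_eq_zero_iff_ae_notMem] at this
  filter_upwards [this] with x hx
  simpa using hx

theorem ae_ne_zero : ∀ᵐ x : Space, x ≠ 0 := by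
  rw [ae_iff]
  simp

/-- A real field, seen as a complex one. -/
def complexify (x : Space) : Displacement := WithLp.toLp 2 fun i => (x i : ℂ)

/-- A real matrix, seen as a complex one. -/
def complexMat (A : Matrix (Fin 3) (Fin 3) ℝ) : Matrix (Fin 3) (Fin 3) ℂ :=
  A.map fun y => (y : ℂ)

theorem hasWeakGradient_truncField {s : ℝ} (hs : 0 < s) :
    HasWeakGradientH1Loc (fun x => complexify (truncField s x))
      (fun x => complexMat (truncGrad s x)) := by
  refine HasWeakGradientH1Loc.of_lipschitz (lipschitzWith_truncField hs) ?_
  filter_upwards [ae_norm_ne hs] with x hx i j using lineDeriv_truncField hs hx i j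

theorem hasWeakGradient_id : HasWeakGradientH1Loc complexify (fun _ => 1) := by
  have := HasWeakGradientH1Loc.of_lipschitz (w := id) (D := fun _ => 1) LipschitzWith.id
    (.of_forall fun x i j => by
      have hd : HasFDerivAt (fun y : Space => y i) (EuclideanSpace.proj i : Space →L[ℝ] ℝ) x :=
        (EuclideanSpace.proj i : Space →L[ℝ] ℝ).hasFDerivAt
      simp only [id]
      rw [hd.differentiableAt.lineDeriv_eq_fderiv, hd.fderiv]
      simp [basisVec, Matrix.one_apply])
  have h1 : complexMat 1 = 1 := by simp [complexMat]
  rw [← h1]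
  exact this

/-! ### Radial test fields and polar coordinates. -/

/-- The field `η(|x|) x`. -/
def radialField (η : ℝ → ℝ) (x : Space) : Displacement := complexify (η ‖x‖ • x)

/-- The norm is not smooth at the origin, so the support condition makes the function vanish near
it. -/
theorem contDiff_comp_norm {η : ℝ → ℝ} (hη : ContDiff ℝ ∞ η) (h0 : tsupport η ⊆ Set.Ioi 0) :
    ContDiff ℝ ∞ fun x : Space => η ‖x‖ := by
  rw [contDiff_iff_contDiffAt]
  intro x
  rcases eq_or_ne x 0 with rfl | hx
  · have h : η =ᶠ[nhds ‖(0 : Space)‖] 0 := by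
      rw [← notMem_tsupport_iff_eventuallyEq]
      intro hm
      simpa using h0 hm
    have h' : (fun x : Space => η ‖x‖) =ᶠ[nhds 0] fun _ => (0 : ℝ) :=
      continuous_norm.continuousAt.eventually h
    exact contDiffAt_const.congr_of_eventuallyEq h'
  · exact hη.contDiffAt.comp x (contDiffAt_norm ℝ hx)

theorem hasCompactSupport_comp_norm {η : ℝ → ℝ} (hc : HasCompactSupport η) :
    HasCompactSupport fun x : Space => η ‖x‖ := by
  obtain ⟨R, hR⟩ := hc.isCompact.isBounded.subset_closedBall 0
  refine HasCompactSupport.intro (isCompact_closedBall (0 : Space) R) fun x hx => ?_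
  by_contra hne
  have := hR (subset_tsupport η hne)
  simp at this hx
  linarith

theorem contDiff_radialField {η : ℝ → ℝ} (hη : ContDiff ℝ ∞ η) (h0 : tsupport η ⊆ Set.Ioi 0) :
    ContDiff ℝ ∞ (radialField η) := by
  rw [contDiff_piLp]
  intro i
  exact Complex.ofRealCLM.contDiff.comp ((contDiff_comp_norm hη h0).mul
    (EuclideanSpace.proj i : Space →L[ℝ] ℝ).contDiff)

theorem hasCompactSupport_radialField {η : ℝ → ℝ} (hc : HasCompactSupport η) :
    HasCompactSupport (radialField η) := by
  refine (hasCompactSupport_comp_norm hc).mono fun x hx => ?_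
  contrapose! hx
  have hx0 : η ‖x‖ = 0 := by simpa using hx
  have : radialField η x = 0 := by
    ext i
    simp [radialField, complexify, hx0]
  simpa using this

theorem jacobian_radialField {η : ℝ → ℝ} (hη : ContDiff ℝ ∞ η) (h0 : tsupport η ⊆ Set.Ioi 0)
    {x : Space} (hx : x ≠ 0) :
    jacobian (radialField η) x = complexMat (radialGrad (η ‖x‖) (deriv η ‖x‖) x) := by
  ext i j
  rw [jacobian_apply_eq_fderiv_component (contDiff_radialField hη h0)]
  obtain ⟨L, hL, hL'⟩ := hasFDerivAt_radial_smul hx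
    ((hη.differentiable (by simp)) ‖x‖).hasDerivAt i
  have : HasFDerivAt (fun y => radialField η y i) (Complex.ofRealCLM.comp L) x :=
    (Complex.ofRealCLM.hasFDerivAt).comp x hL
  rw [this.fderiv]
  simp [hL', complexMat]

/-- The area of the unit sphere. -/
def sphereArea : ℝ := 3 * volume.real (Metric.ball (0 : Space) 1)

theorem sphereArea_pos : 0 < sphereArea := by
  have : 0 < volume.real (Metric.ball (0 : Space) 1) :=
    ENNReal.toReal_pos (Metric.measure_ball_pos volume 0 one_pos).ne' measure_ball_lt_top.ne
  unfold sphereArea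
  positivity

theorem integral_comp_norm (f : ℝ → ℂ) :
    ∫ x : Space, f ‖x‖ = sphereArea * ∫ ρ in Set.Ioi (0 : ℝ), (ρ : ℂ) ^ 2 * f ρ := by
  rw [integral_fun_norm_addHaar volume f]
  simp [sphereArea, nsmul_eq_mul, mul_assoc]

theorem energyDensity_of_transpose_left {l m : ℂ} {A B : Matrix (Fin 3) (Fin 3) ℂ} (hA : Aᵀ = A) :
    energyDensity l m A B = l * (A.trace * B.trace) + 2 * m * (A * B).trace := by
  have h : ∀ i j, A j i = A i j := fun i j => congrFun (congrFun hA i) j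
  simp only [energyDensity, strain, Matrix.trace, Matrix.diag, Matrix.mul_apply,
    Fin.sum_univ_three, Matrix.smul_apply, Matrix.add_apply, Matrix.transpose_apply, smul_eq_mul,
    h 0 1, h 0 2, h 1 2]
  ring

/-- The contraction of strains only sees symmetric parts, so symmetry of one factor is enough. This
version serves radial test fields, paired with a weak gradient not known to be symmetric. -/
theorem energyDensity_of_transpose_right {l m : ℂ} {A B : Matrix (Fin 3) (Fin 3) ℂ} (hB : Bᵀ = B) :
    energyDensity l m A B = l * (A.trace * B.trace) + 2 * m * (A * B).trace := by
  have h : ∀ i j, B j i = B i j := fun i j => congrFun (congrFun hB i) j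
  simp only [energyDensity, strain, Matrix.trace, Matrix.diag, Matrix.mul_apply,
    Fin.sum_univ_three, Matrix.smul_apply, Matrix.add_apply, Matrix.transpose_apply, smul_eq_mul,
    h 0 1, h 0 2, h 1 2]
  ring

/-! ### Integral identities against test fields. -/

section TestFields

variable {u : Space → Displacement} {G : Space → Matrix (Fin 3) (Fin 3) ℂ}
  {φ : Space → Displacement}

theorem HasWeakGradientH1Loc.integrable_mul_jacobian (h : HasWeakGradientH1Loc u G)
    (hφ : ContDiff ℝ ∞ φ) (hc : HasCompactSupport φ) (i j k l : Fin 3) :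
    Integrable fun x => G x i j * jacobian φ x k l :=
  integrable_mul_of_hasCompactSupport (h.locallyIntegrable_grad i j)
    (contDiff_jacobian hφ k l).continuous (hasCompactSupport_jacobian hφ hc k l)

theorem HasWeakGradientH1Loc.integrable_trace_mul (h : HasWeakGradientH1Loc u G)
    (hφ : ContDiff ℝ ∞ φ) (hc : HasCompactSupport φ) :
    Integrable fun x => (G x * jacobian φ x).trace := by
  simp only [Matrix.trace, Matrix.diag, Matrix.mul_apply]
  exact integrable_finsetSum _ fun i _ => integrable_finsetSum _ fun j _ =>
    h.integrable_mul_jacobian hφ hc i j j i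

theorem HasWeakGradientH1Loc.integrable_trace_mul_trace (h : HasWeakGradientH1Loc u G)
    (hφ : ContDiff ℝ ∞ φ) (hc : HasCompactSupport φ) :
    Integrable fun x => (G x).trace * (jacobian φ x).trace := by
  simp only [Matrix.trace, Matrix.diag, Finset.sum_mul_sum]
  exact integrable_finsetSum _ fun i _ => integrable_finsetSum _ fun j _ =>
    h.integrable_mul_jacobian hφ hc i i j j

theorem HasWeakGradientH1Loc.integral_trace_mul (h : HasWeakGradientH1Loc u G)
    (hφ : ContDiff ℝ ∞ φ) (hc : HasCompactSupport φ) :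
    ∫ x, (G x * jacobian φ x).trace = ∫ x, (G x).trace * (jacobian φ x).trace :=
  h.integral_sum_mul_eq_integral_trace_mul_trace hφ hc

theorem integrable_trace_jacobian (hφ : ContDiff ℝ ∞ φ) (hc : HasCompactSupport φ) :
    Integrable fun x => (jacobian φ x).trace :=
  integrable_finsetSum _ fun i _ =>
    (contDiff_jacobian hφ i i).continuous.integrable_of_hasCompactSupport
      (hasCompactSupport_jacobian hφ hc i i)

/-- For the identity field the null Lagrangian identity reads I = 3 I. -/
theorem integral_trace_jacobian (hφ : ContDiff ℝ ∞ φ) (hc : HasCompactSupport φ) :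
    ∫ x, (jacobian φ x).trace = 0 := by
  have h := hasWeakGradient_id.integral_trace_mul hφ hc
  simp only [Matrix.one_mul, Matrix.trace_one, Fintype.card_fin, integral_const_mul] at h
  push_cast at h
  linear_combination (-1 / 2 : ℂ) * h

/-- A divergence free matrix field that is a multiple of the identity inside the ball of radius `s`
and the gradient of `x / |x|³` outside. -/
def truncStress (s : ℝ) (x : Space) : Matrix (Fin 3) (Fin 3) ℂ :=
  ((s : ℂ) ^ 3)⁻¹ • (complexMat (truncGrad s x) - (complexMat (truncGrad s x)).trace • 1)

theorem integrable_truncStress {s : ℝ} (hs : 0 < s) (hφ : ContDiff ℝ ∞ φ)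
    (hc : HasCompactSupport φ) : Integrable fun x => (truncStress s x * jacobian φ x).trace := by
  have h := hasWeakGradient_truncField hs
  have := ((h.integrable_trace_mul hφ hc).sub (h.integrable_trace_mul_trace hφ hc)).const_mul
    ((s : ℂ) ^ 3)⁻¹
  simpa [truncStress, Matrix.sub_mul, Matrix.trace_sub, Matrix.trace_smul] using this

/-- The stress is a multiple of G - (tr G) I with G a weak gradient, and the null Lagrangian
identity says that the two terms have equal integrals against a test Jacobian. -/
theorem integral_truncStress {s : ℝ} (hs : 0 < s) (hφ : ContDiff ℝ ∞ φ)
    (hc : HasCompactSupport φ) : ∫ x, (truncStress s x * jacobian φ x).trace = 0 := by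
  have h := hasWeakGradient_truncField hs
  simp only [truncStress, Matrix.smul_mul, Matrix.sub_mul, Matrix.trace_sub, Matrix.trace_smul,
    Matrix.one_mul, smul_eq_mul]
  rw [integral_const_mul, integral_sub (h.integrable_trace_mul hφ hc)
    (h.integrable_trace_mul_trace hφ hc), h.integral_trace_mul hφ hc, sub_self, mul_zero]

end TestFields

/-- The gradient of `x / |x|³`. -/
def coulombGrad (x : Space) : Matrix (Fin 3) (Fin 3) ℂ :=
  complexMat (radialGrad (1 / ‖x‖ ^ 3) (-3 / ‖x‖ ^ 4) x)

theorem complexMat_transpose_radialGrad (p q : ℝ) (x : Space) :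
    (complexMat (radialGrad p q x))ᵀ = complexMat (radialGrad p q x) := by
  rw [complexMat, ← Matrix.transpose_map, radialGrad_transpose]

theorem trace_complexMat (A : Matrix (Fin 3) (Fin 3) ℝ) :
    (complexMat A).trace = ((A.trace : ℝ) : ℂ) := by
  simp [complexMat, Matrix.trace]

theorem trace_coulombGrad (x : Space) : (coulombGrad x).trace = 0 := by
  rw [coulombGrad, trace_complexMat, trace_radialGrad]
  rcases eq_or_ne ‖x‖ 0 with h | h
  -- At the origin division by zero gives 0, which happens to be the required trace.
  · simp [h]
  · rw [Complex.ofReal_eq_zero]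
    field_simp
    norm_num

theorem complexMat_truncGrad_of_le {s : ℝ} {x : Space} (hx : ‖x‖ ≤ s) :
    complexMat (truncGrad s x) = 1 := by
  simp [truncGrad, hx, complexMat]

theorem complexMat_truncGrad_of_lt {s : ℝ} {x : Space} (hx : s < ‖x‖) :
    complexMat (truncGrad s x) = (s : ℂ) ^ 3 • coulombGrad x := by
  rw [truncGrad, if_neg hx.not_ge]
  ext i j
  simp only [complexMat, radialGrad, coulombGrad, Matrix.map_apply, Matrix.of_apply,
    Matrix.smul_apply, smul_eq_mul]
  push_cast
  ring

theorem truncStress_of_le {s : ℝ} {x : Space} (hx : ‖x‖ ≤ s) :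
    truncStress s x = (-2 * ((s : ℂ) ^ 3)⁻¹) • (1 : Matrix (Fin 3) (Fin 3) ℂ) := by
  rw [truncStress, complexMat_truncGrad_of_le hx, Matrix.trace_one]
  push_cast [Fintype.card_fin]
  module

theorem truncStress_of_lt {s : ℝ} (hs : 0 < s) {x : Space} (hx : s < ‖x‖) :
    truncStress s x = coulombGrad x := by
  have : (s : ℂ) ^ 3 ≠ 0 := by simp [hs.ne']
  rw [truncStress, complexMat_truncGrad_of_lt hx, Matrix.trace_smul, trace_coulombGrad]
  simp [smul_smul, this]

/-! ### Combinatorics of the layers. -/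

/-- The radii of the interfaces are positive and strictly decreasing. -/
structure IsRadii (N : ℕ) (r : ℕ → ℝ) : Prop where
  one_le : 1 ≤ N
  pos : ∀ j, 1 ≤ j → j ≤ N → 0 < r j
  anti : ∀ j, 1 ≤ j → j < N → r (j + 1) < r j

namespace IsRadii

variable {N : ℕ} {r : ℕ → ℝ}

theorem lt_of_lt (h : IsRadii N r) {i j : ℕ} (hi : 1 ≤ i) (hij : i < j) (hj : j ≤ N) :
    r j < r i := by
  induction j, hij using Nat.le_induction with
  | base => exact h.anti i hi (by omega)
  | succ j hij ih => exact (h.anti j (by omega) (by omega)).trans (ih (by omega))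

theorem le_of_le (h : IsRadii N r) {i j : ℕ} (hi : 1 ≤ i) (hij : i ≤ j) (hj : j ≤ N) :
    r j ≤ r i := by
  rcases hij.eq_or_lt with rfl | hlt
  · exact le_rfl
  · exact (h.lt_of_lt hi hlt hj).le

theorem pos_succ (h : IsRadii N r) {i : ℕ} (hi : i < N) : 0 < r (i + 1) :=
  h.pos _ (by omega) (by omega)

theorem mem_layer_iff (h : IsRadii N r) {j : ℕ} (hj : j ≤ N) {x : Space} :
    x ∈ layer N r j ↔ (j ≠ 0 → ‖x‖ ≤ r j) ∧ (j ≠ N → r (j + 1) < ‖x‖) := by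
  have := h.one_le
  rcases eq_or_ne j 0 with rfl | h0
  · have : N ≠ 0 := by omega
    simp [layer, this.symm]
  · rcases hj.eq_or_lt with rfl | hlt
    · simp [layer, h0]
    · simp [layer, h0, hlt, hlt.ne, and_comm]

/-- Turns membership in a ball into an inequality of indices, so that pointwise sums over interfaces
telescope. -/
theorem norm_le_iff_of_mem_layer (h : IsRadii N r) {i j : ℕ} (hi : i < N) (hj : j ≤ N)
    {x : Space} (hx : x ∈ layer N r j) : ‖x‖ ≤ r (i + 1) ↔ i < j := by
  rw [h.mem_layer_iff hj] at hx
  constructor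
  · intro hle
    by_contra! hji
    have h1 := hx.2 (by omega)
    have h2 := h.le_of_le (i := j + 1) (j := i + 1) (by omega) (by omega) (by omega)
    linarith
  · intro hij
    exact (hx.1 (by omega)).trans (h.le_of_le (by omega) (by omega) (by omega))

theorem exists_mem_layer (h : IsRadii N r) (x : Space) : ∃ j ≤ N, x ∈ layer N r j := by
  classical
  -- The layer index is the largest j with |x| ≤ r j; admitting j = 0 unconditionally covers the
  -- exterior.
  let s := (Finset.range (N + 1)).filter fun j => j = 0 ∨ ‖x‖ ≤ r j
  have hs : s.Nonempty := ⟨0, by simp [s]⟩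
  obtain ⟨m, hm, hmax⟩ := s.exists_max_image id hs
  simp only [s, Finset.mem_filter, Finset.mem_range] at hm
  refine ⟨m, by omega, (h.mem_layer_iff (by omega)).2 ⟨fun h0 => hm.2.resolve_left h0,
    fun hN => ?_⟩⟩
  by_contra! hle
  have := hmax (m + 1) (by
    simp only [s, Finset.mem_filter, Finset.mem_range]
    exact ⟨by omega, Or.inr hle⟩)
  simp at this

theorem eq_of_mem_layer (h : IsRadii N r) {j k : ℕ} (hj : j ≤ N) (hk : k ≤ N) {x : Space}
    (hxj : x ∈ layer N r j) (hxk : x ∈ layer N r k) : j = k := by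
  by_contra hne
  wlog hlt : j < k generalizing j k
  · exact this hk hj hxk hxj (Ne.symm hne) (by omega)
  have h1 := (h.norm_le_iff_of_mem_layer (i := j) (by omega) hk hxk).2 hlt
  exact lt_irrefl _ ((h.norm_le_iff_of_mem_layer (i := j) (by omega) hj hxj).1 h1)

theorem coeff_eq (h : IsRadii N r) (ε : ℕ → ℂ) {j : ℕ} (hj : j ≤ N) {x : Space}
    (hx : x ∈ layer N r j) : coeff N r ε x = ε j := by
  rw [coeff, Finset.sum_eq_single j]
  · simp [hx]
  · intro k hk hne
    rw [Set.indicator_of_notMem]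
    intro hxk
    exact hne (h.eq_of_mem_layer (by simpa [Nat.lt_succ_iff] using hk) hj hxk hx)
  · intro hn
    simp at hn
    omega

/-- Summation by parts over the layers. -/
theorem sum_layer (h : IsRadii N r) {M : Type*} [AddCommGroup M] (A B : ℕ → M) {j : ℕ}
    (hj : j ≤ N) {x : Space} (hx : x ∈ layer N r j) :
    ∑ i ∈ Finset.range N, (if ‖x‖ ≤ r (i + 1) then A (i + 1) - A i else B i - B (i + 1)) =
      A j - A 0 + (B j - B N) := by
  have h1 : ∀ i ∈ Finset.range N,
      (if ‖x‖ ≤ r (i + 1) then A (i + 1) - A i else B i - B (i + 1)) =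
        if i < j then A (i + 1) - A i else B i - B (i + 1) := fun i hi => by
    simp only [h.norm_le_iff_of_mem_layer (Finset.mem_range.1 hi) hj hx]
  rw [Finset.sum_congr rfl h1, ← Finset.sum_range_add_sum_Ico _ hj]
  congr 1
  · rw [← Finset.sum_range_sub]
    exact Finset.sum_congr rfl fun i hi => by simp [Finset.mem_range.1 hi]
  · rw [← neg_sub, ← Finset.sum_Ico_sub _ hj, ← Finset.sum_neg_distrib]
    refine Finset.sum_congr rfl fun i hi => ?_
    have := (Finset.mem_Ico.1 hi).1
    simp [not_lt.2 this]

end IsRadii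

/-! ### Layered fields as superpositions of truncated fields. -/

/-- The continuous layered radial field with value `a₀` and jumps `p i` of the linear
coefficient. -/
def layeredField (N : ℕ) (r : ℕ → ℝ) (a₀ : ℂ) (p : ℕ → ℂ) (x : Space) : Displacement :=
  a₀ • complexify x + ∑ i ∈ Finset.range N, p i • complexify (truncField (r (i + 1)) x)

/-- The gradient of `layeredField`. -/
def layeredGrad (N : ℕ) (r : ℕ → ℝ) (a₀ : ℂ) (p : ℕ → ℂ) (x : Space) :
    Matrix (Fin 3) (Fin 3) ℂ :=
  a₀ • (1 : Matrix (Fin 3) (Fin 3) ℂ) +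
    ∑ i ∈ Finset.range N, p i • complexMat (truncGrad (r (i + 1)) x)

/-- The jumps of the linear coefficient forced by continuity across the interfaces. -/
def coulombJump (r : ℕ → ℝ) (b : ℕ → ℂ) (i : ℕ) : ℂ := (b i - b (i + 1)) * ((r (i + 1) : ℂ) ^ 3)⁻¹

/-- The defect of continuity at the interface `|x| = r (i + 1)`. -/
def fieldDefect (r : ℕ → ℝ) (a b : ℕ → ℂ) (i : ℕ) : ℂ := a (i + 1) - a i - coulombJump r b i

/-- The defect of continuity of the traction at the interface `|x| = r (i + 1)`. -/
def tractionDefect (r : ℕ → ℝ) (lam mu : ℝ) (ε a b : ℕ → ℂ) (i : ℕ) : ℂ :=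
  (3 * lam + 2 * mu) * (ε (i + 1) * a (i + 1) - ε i * a i) +
    4 * mu * (ε i * b i - ε (i + 1) * b (i + 1)) * ((r (i + 1) : ℂ) ^ 3)⁻¹

theorem complexify_smul (t : ℝ) (x : Space) : complexify (t • x) = (t : ℂ) • complexify x := by
  ext i
  simp [complexify]

namespace IsRadii

variable {N : ℕ} {r : ℕ → ℝ} {a b : ℕ → ℂ} {j : ℕ} {x : Space}

theorem hasWeakGradient_layered (h : IsRadii N r) (a₀ : ℂ) (p : ℕ → ℂ) :
    HasWeakGradientH1Loc (layeredField N r a₀ p) (layeredGrad N r a₀ p) := by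
  have h1 := (hasWeakGradient_id.const_smul a₀).add (HasWeakGradientH1Loc.sum (Finset.range N)
    fun i hi => (hasWeakGradient_truncField (h.pos_succ (Finset.mem_range.1 hi))).const_smul (p i))
  convert h1 using 1
  · ext1 x
    simp [layeredField, Finset.sum_apply]
  · ext1 x
    simp [layeredGrad, Finset.sum_apply]

/-- Summation by parts over the interfaces. Continuity is not assumed: the discontinuous part of an
arbitrary layered field is split off as a step function times x, the form needed to prove later that
it vanishes. -/
theorem field_eq (h : IsRadii N r) (hb : b N = 0) (hj : j ≤ N) (hx : x ∈ layer N r j) :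
    (a j + b j * (((‖x‖ ^ 3)⁻¹ : ℝ) : ℂ)) • complexify x =
      layeredField N r (a 0) (coulombJump r b) x +
        ∑ i ∈ Finset.range N,
          (if ‖x‖ ≤ r (i + 1) then fieldDefect r a b i else 0) • complexify x := by
  have hs := h.sum_layer (fun i => a i • complexify x)
    (fun i => (b i * (((‖x‖ ^ 3)⁻¹ : ℝ) : ℂ)) • complexify x) hj hx
  simp only [hb, zero_mul, zero_smul, sub_zero] at hs
  rw [layeredField, add_assoc, ← Finset.sum_add_distrib, add_smul, ← sub_eq_iff_eq_add',
    add_sub_right_comm, ← hs]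
  refine Finset.sum_congr rfl fun i hi => ?_
  have hr := h.pos_succ (Finset.mem_range.1 hi)
  have hr' : (r (i + 1) : ℂ) ≠ 0 := by exact_mod_cast hr.ne'
  split_ifs with hle
  · rw [truncField_of_le hr hle, fieldDefect]
    module
  · rw [truncField_of_lt (not_le.1 hle), complexify_smul, zero_smul, add_zero, smul_smul,
      ← sub_smul, coulombJump]
    congr 1
    push_cast
    field_simp

theorem grad_eq (h : IsRadii N r) (hb : b N = 0) (hd : ∀ i < N, fieldDefect r a b i = 0)
    (hj : j ≤ N) (hx : x ∈ layer N r j) :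
    layeredGrad N r (a 0) (coulombJump r b) x =
      a j • (1 : Matrix (Fin 3) (Fin 3) ℂ) + b j • coulombGrad x := by
  have hs := h.sum_layer (fun i => a i • (1 : Matrix (Fin 3) (Fin 3) ℂ))
    (fun i => b i • coulombGrad x) hj hx
  simp only [hb, zero_smul, sub_zero] at hs
  rw [layeredGrad, ← eq_sub_iff_add_eq', add_sub_right_comm, ← hs]
  refine Finset.sum_congr rfl fun i hi => ?_
  have hr := h.pos_succ (Finset.mem_range.1 hi)
  have hr' : (r (i + 1) : ℂ) ≠ 0 := by exact_mod_cast hr.ne'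
  have hdi := hd i (Finset.mem_range.1 hi)
  split_ifs with hle
  · rw [complexMat_truncGrad_of_le hle, ← sub_smul]
    congr 1
    rw [fieldDefect] at hdi
    linear_combination -hdi
  · rw [complexMat_truncGrad_of_lt (not_le.1 hle), smul_smul, ← sub_smul, coulombJump]
    congr 1
    field_simp

/-- Pointwise the stress is a constant multiple of I, plus divergence free truncated stresses, plus
multiples of I on the balls. Each truncated stress is chosen to equal the Coulomb gradient outside
its ball; the constant -2 s⁻³ it takes inside turns 2μ into the coefficient 4μ of the traction
defect. -/
theorem energyDensity_layered (h : IsRadii N r) (hb : b N = 0)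
    (hd : ∀ i < N, fieldDefect r a b i = 0) (lam mu : ℝ) (ε : ℕ → ℂ) (c : ℂ) (x : Space)
    (B : Matrix (Fin 3) (Fin 3) ℂ) :
    energyDensity (coeff N r ε x * lam) (coeff N r ε x * mu)
        (c • layeredGrad N r (a 0) (coulombJump r b) x) B =
      c * ((3 * lam + 2 * mu) * (ε 0 * a 0) * B.trace +
        ∑ i ∈ Finset.range N, (2 * mu * (ε i * b i - ε (i + 1) * b (i + 1)) *
            (truncStress (r (i + 1)) x * B).trace +
          tractionDefect r lam mu ε a b i * (if ‖x‖ ≤ r (i + 1) then B.trace else 0))) := by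
  obtain ⟨j, hj, hx⟩ := h.exists_mem_layer x
  have hs := h.sum_layer (fun i => (3 * lam + 2 * mu) * (ε i * a i) * B.trace)
    (fun i => 2 * mu * (ε i * b i) * (coulombGrad x * B).trace) hj hx
  simp only [hb, mul_zero, zero_mul, sub_zero] at hs
  have hsum : ∑ i ∈ Finset.range N, (2 * mu * (ε i * b i - ε (i + 1) * b (i + 1)) *
            (truncStress (r (i + 1)) x * B).trace +
          tractionDefect r lam mu ε a b i * (if ‖x‖ ≤ r (i + 1) then B.trace else 0)) =
      (3 * lam + 2 * mu) * (ε j * a j) * B.trace - (3 * lam + 2 * mu) * (ε 0 * a 0) * B.trace +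
        2 * mu * (ε j * b j) * (coulombGrad x * B).trace := by
    rw [← hs]
    refine Finset.sum_congr rfl fun i hi => ?_
    have hr := h.pos_succ (Finset.mem_range.1 hi)
    split_ifs with hle
    · rw [truncStress_of_le hle, Matrix.smul_mul, Matrix.trace_smul, Matrix.one_mul, smul_eq_mul,
        tractionDefect]
      ring
    · rw [truncStress_of_lt hr (not_le.1 hle)]
      ring
  have hsymm : (coulombGrad x)ᵀ = coulombGrad x := complexMat_transpose_radialGrad _ _ _
  rw [hsum, h.coeff_eq ε hj hx, h.grad_eq hb hd hj hx, energyDensity_of_transpose_left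
    (by simp [hsymm])]
  simp only [Matrix.smul_mul, Matrix.add_mul, Matrix.one_mul, Matrix.trace_add, Matrix.trace_smul,
    Matrix.trace_one, trace_coulombGrad, smul_eq_mul, Fintype.card_fin]
  push_cast
  ring

/-- The constant stress and the truncated stresses integrate to zero against a test Jacobian, so
only the balls weighted by the traction defects remain. -/
theorem integral_energyDensity_layered (h : IsRadii N r) (hb : b N = 0)
    (hd : ∀ i < N, fieldDefect r a b i = 0) (lam mu : ℝ) (ε : ℕ → ℂ) (c : ℂ)
    {φ : Space → Displacement} (hφ : ContDiff ℝ ∞ φ) (hc : HasCompactSupport φ) :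
    ∫ x, energyDensity (coeff N r ε x * lam) (coeff N r ε x * mu)
        (c • layeredGrad N r (a 0) (coulombJump r b) x) (jacobian φ x) =
      c * ∑ i ∈ Finset.range N, tractionDefect r lam mu ε a b i *
        ∫ x, if ‖x‖ ≤ r (i + 1) then (jacobian φ x).trace else 0 := by
  simp only [h.energyDensity_layered hb hd]
  have hball : ∀ s : ℝ, Integrable fun x : Space => if ‖x‖ ≤ s then (jacobian φ x).trace else 0 :=
    fun s => (integrable_trace_jacobian hφ hc).indicator (s := {x : Space | ‖x‖ ≤ s})
      (measurableSet_le measurable_norm measurable_const)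
  have hstress : ∀ i ∈ Finset.range N,
      Integrable fun x => (truncStress (r (i + 1)) x * jacobian φ x).trace := fun i hi =>
    integrable_truncStress (h.pos_succ (Finset.mem_range.1 hi)) hφ hc
  rw [integral_const_mul, integral_add ((integrable_trace_jacobian hφ hc).const_mul _),
    integral_const_mul, integral_trace_jacobian hφ hc, mul_zero, zero_add,
    integral_finsetSum]
  · congr 1
    refine Finset.sum_congr rfl fun i hi => ?_
    rw [integral_add ((hstress i hi).const_mul _) ((hball _).const_mul _), integral_const_mul,
      integral_const_mul, integral_truncStress (h.pos_succ (Finset.mem_range.1 hi)) hφ hc,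
      mul_zero, zero_add]
  · exact fun i hi => ((hstress i hi).const_mul _).add ((hball _).const_mul _)
  · exact integrable_finsetSum _ fun i hi => ((hstress i hi).const_mul _).add ((hball _).const_mul _)

end IsRadii

/-! ### The transmission conditions as a linear system. -/

section Algebra

variable {N : ℕ} {r : ℕ → ℝ} {lam mu : ℝ} {ε a b : ℕ → ℂ}

/-- Above the diagonal ℙ is constant and below it is a quotient of cubes, so a row of ℙᵀ p splits
into a partial sum of the p_i and a tail sum of the p_i r_{i+1}³, that is, into a_j - a₀ and
b_{j+1}. -/
theorem transpose_momentumMatrix_mulVec (p : ℕ → ℂ) {j : ℕ} (hj : j < N) :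
    ((momentumMatrix N r lam mu ε)ᵀ *ᵥ fun i : Fin N => p i) ⟨j, hj⟩ =
      beta lam mu ε (j + 1) * p j - ∑ i ∈ Finset.range j, p i +
        xi lam mu * ((r (j + 1) : ℂ) ^ 3)⁻¹ *
          ∑ i ∈ Finset.Ico (j + 1) N, p i * (r (i + 1) : ℂ) ^ 3 := by
  have h1 : ((momentumMatrix N r lam mu ε)ᵀ *ᵥ fun i : Fin N => p i) ⟨j, hj⟩ =
      ∑ i ∈ Finset.range N, (if i = j then beta lam mu ε (i + 1) else if i < j then -1
        else ((xi lam mu * (r (i + 1) / r (j + 1)) ^ 3 : ℝ) : ℂ)) * p i := by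
    rw [← Fin.sum_univ_eq_sum_range]
    simp [Matrix.mulVec, dotProduct, momentumMatrix, Fin.ext_iff, Fin.lt_def,
      -Fin.val_fin_lt]
  rw [h1, ← Finset.sum_range_add_sum_Ico _ hj, Finset.sum_range_succ]
  have h2 : ∀ i ∈ Finset.range j, (if i = j then beta lam mu ε (i + 1) else if i < j then -1
        else ((xi lam mu * (r (i + 1) / r (j + 1)) ^ 3 : ℝ) : ℂ)) * p i = - p i := fun i hi => by
    have := Finset.mem_range.1 hi
    simp [this, this.ne]
  have h3 : ∀ i ∈ Finset.Ico (j + 1) N, (if i = j then beta lam mu ε (i + 1)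
        else if i < j then -1
        else ((xi lam mu * (r (i + 1) / r (j + 1)) ^ 3 : ℝ) : ℂ)) * p i =
      xi lam mu * ((r (j + 1) : ℂ) ^ 3)⁻¹ * (p i * (r (i + 1) : ℂ) ^ 3) := fun i hi => by
    have := (Finset.mem_Ico.1 hi).1
    rw [if_neg (by omega), if_neg (by omega)]
    push_cast
    rw [div_pow]
    ring
  rw [Finset.sum_congr rfl h2, Finset.sum_congr rfl h3, Finset.sum_neg_distrib, ← Finset.mul_sum,
    if_pos rfl]
  ring

theorem tractionDefect_eq_zero_iff (hr : IsRadii N r) (hconv : 0 < 3 * lam + 2 * mu)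
    {j : ℕ} (hj : j < N) (hε : ε j ≠ ε (j + 1)) (hd : fieldDefect r a b j = 0) :
    tractionDefect r lam mu ε a b j = 0 ↔
      beta lam mu ε (j + 1) * coulombJump r b j - a j +
        xi lam mu * ((r (j + 1) : ℂ) ^ 3)⁻¹ * b (j + 1) = 0 := by
  have hr' : (r (j + 1) : ℂ) ≠ 0 := by exact_mod_cast (hr.pos_succ hj).ne'
  have hk : (3 * lam + 2 * mu : ℂ) ≠ 0 := by exact_mod_cast hconv.ne'
  have hε' : ε j - ε (j + 1) ≠ 0 := sub_ne_zero.2 hε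
  -- With a_{j+1} eliminated through continuity, the defect factors; the nonzero factors are where
  -- ε_j ≠ ε_{j+1} and 3λ + 2μ > 0 enter.
  have key : tractionDefect r lam mu ε a b j = (3 * lam + 2 * mu) * (ε j - ε (j + 1)) *
      (beta lam mu ε (j + 1) * coulombJump r b j - a j +
        xi lam mu * ((r (j + 1) : ℂ) ^ 3)⁻¹ * b (j + 1)) := by
    have ha : a (j + 1) = a j + coulombJump r b j := by
      rw [fieldDefect] at hd
      linear_combination hd
    rw [tractionDefect, ha, coulombJump, beta, xi, Nat.add_sub_cancel]
    push_cast
    field_simp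
    ring
  rw [key, mul_eq_zero, or_iff_right (mul_ne_zero hk hε')]

theorem eq_add_sum_of_fieldDefect (hd : ∀ i < N, fieldDefect r a b i = 0) {j : ℕ} (hj : j ≤ N) :
    a j = a 0 + ∑ i ∈ Finset.range j, coulombJump r b i := by
  have : ∀ i ∈ Finset.range j, coulombJump r b i = a (i + 1) - a i := fun i hi => by
    have := hd i (by have := Finset.mem_range.1 hi; omega)
    rw [fieldDefect] at this
    linear_combination -this
  rw [Finset.sum_congr rfl this, Finset.sum_range_sub]
  ring

theorem eq_sum_coulombJump (hr : IsRadii N r) (hb : b N = 0) {j : ℕ} (hj : j ≤ N) :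
    b j = ∑ i ∈ Finset.Ico j N, coulombJump r b i * (r (i + 1) : ℂ) ^ 3 := by
  have : ∀ i ∈ Finset.Ico j N, coulombJump r b i * (r (i + 1) : ℂ) ^ 3 = -(b (i + 1) - b i) :=
    fun i hi => by
      have hr' : (r (i + 1) : ℂ) ≠ 0 := by
        exact_mod_cast (hr.pos_succ (Finset.mem_Ico.1 hi).2).ne'
      rw [coulombJump]
      field_simp
      ring
  rw [Finset.sum_congr rfl this, Finset.sum_neg_distrib, Finset.sum_Ico_sub _ hj, hb]
  ring

/-- The transmission conditions as a linear system for the jumps. -/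
theorem forall_tractionDefect_eq_zero_iff (hr : IsRadii N r)
    (hconv : 0 < 3 * lam + 2 * mu) (hε : ∀ i < N, ε i ≠ ε (i + 1)) (hb : b N = 0)
    (hd : ∀ i < N, fieldDefect r a b i = 0) :
    (∀ i < N, tractionDefect r lam mu ε a b i = 0) ↔
      (momentumMatrix N r lam mu ε)ᵀ *ᵥ (fun i : Fin N => coulombJump r b i) =
        a 0 • onesVec N := by
  have key : ∀ j (hj : j < N), tractionDefect r lam mu ε a b j = 0 ↔
      ((momentumMatrix N r lam mu ε)ᵀ *ᵥ fun i : Fin N => coulombJump r b i) ⟨j, hj⟩ = a 0 := by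
    intro j hj
    rw [tractionDefect_eq_zero_iff hr hconv hj (hε j hj) (hd j hj),
      transpose_momentumMatrix_mulVec _ hj, ← eq_sum_coulombJump hr hb (by omega),
      eq_add_sum_of_fieldDefect hd hj.le, ← sub_eq_zero (b := a 0)]
    ring_nf
  simp only [funext_iff, Pi.smul_apply, onesVec, smul_eq_mul, mul_one]
  exact ⟨fun h i => (key i i.2).1 (h i i.2), fun h i hi => (key i hi).2 (h ⟨i, hi⟩)⟩

end Algebra

/-! ### Existence of the layered solution and necessity of the traction conditions. -/

section

/-- The constant `γ₁⁰ Y₀⁰` of the uniform mode. -/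
def modeConst (lam mu : ℝ) : ℂ :=
  ((2 * mu / (3 * lam + 5 * mu) * (1 / Real.sqrt (4 * Real.pi)) : ℝ) : ℂ)

theorem uniformMode_eq (lam mu : ℝ) (x : Space) :
    uniformMode lam mu x = modeConst lam mu • complexify x := by
  ext i
  simp [uniformMode, modeConst, complexify]

theorem modeConst_ne_zero {lam mu : ℝ} (hmu : 0 < mu) (hconv : 0 < 3 * lam + 2 * mu) :
    modeConst lam mu ≠ 0 := by
  have h1 : 0 < 3 * lam + 5 * mu := by linarith
  have h2 : 0 < Real.sqrt (4 * Real.pi) := Real.sqrt_pos.2 (by positivity)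
  have : 0 < 2 * mu / (3 * lam + 5 * mu) * (1 / Real.sqrt (4 * Real.pi)) := by positivity
  rw [modeConst, Complex.ofReal_ne_zero]
  exact this.ne'

theorem norm_complexify (x : Space) : ‖complexify x‖ = ‖x‖ := by
  simp [EuclideanSpace.norm_eq, complexify]

section Coefficients

variable {N : ℕ} {r : ℕ → ℝ} {a₀ : ℂ} {p : ℕ → ℂ}

/-- The coefficients of the linear mode in the layers. -/
def linearCoeff (a₀ : ℂ) (p : ℕ → ℂ) (j : ℕ) : ℂ := a₀ + ∑ i ∈ Finset.range j, p i

/-- The coefficients of the decaying mode in the layers. -/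
def decayCoeff (N : ℕ) (r : ℕ → ℝ) (p : ℕ → ℂ) (j : ℕ) : ℂ :=
  ∑ i ∈ Finset.Ico j N, p i * (r (i + 1) : ℂ) ^ 3

theorem coulombJump_decayCoeff (hr : IsRadii N r) {i : ℕ} (hi : i < N) :
    coulombJump r (decayCoeff N r p) i = p i := by
  have hr' : (r (i + 1) : ℂ) ≠ 0 := by exact_mod_cast (hr.pos_succ hi).ne'
  rw [coulombJump, decayCoeff, decayCoeff, ← Finset.sum_Ioo_add_eq_sum_Ico hi,
    show Finset.Ioo i N = Finset.Ico (i + 1) N from rfl]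
  field_simp
  ring

theorem fieldDefect_coeff (hr : IsRadii N r) {i : ℕ} (hi : i < N) :
    fieldDefect r (linearCoeff a₀ p) (decayCoeff N r p) i = 0 := by
  rw [fieldDefect, coulombJump_decayCoeff hr hi, linearCoeff, linearCoeff, Finset.sum_range_succ]
  ring

end Coefficients

variable {N : ℕ} {r : ℕ → ℝ} {lam mu : ℝ} {ε a b : ℕ → ℂ}

theorem background_eq (lam mu : ℝ) (a₀ : ℂ) (x : Space) :
    background lam mu a₀ x = (modeConst lam mu * a₀) • complexify x := by
  rw [background, uniformMode_eq, smul_smul, mul_comm]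

/-- The field with coefficients `a`, `b` in the layers, when these match continuously. -/
theorem IsRadii.smul_layeredField_eq (h : IsRadii N r) (hb : b N = 0)
    (hd : ∀ i < N, fieldDefect r a b i = 0) {j : ℕ} (hj : j ≤ N) {x : Space}
    (hx : x ∈ layer N r j) :
    modeConst lam mu • layeredField N r (a 0) (coulombJump r b) x =
      (a j + b j * (((‖x‖ ^ 3)⁻¹ : ℝ) : ℂ)) • uniformMode lam mu x := by
  have h1 : ∑ i ∈ Finset.range N,
      (if ‖x‖ ≤ r (i + 1) then fieldDefect r a b i else 0) • complexify x = 0 :=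
    Finset.sum_eq_zero fun i hi => by simp [hd i (Finset.mem_range.1 hi)]
  rw [uniformMode_eq, smul_comm, h.field_eq hb hj hx, h1, add_zero]

theorem IsRadii.isLameSolution_layered (h : IsRadii N r) (hb : b N = 0)
    (hd : ∀ i < N, fieldDefect r a b i = 0)
    (ht : ∀ i < N, tractionDefect r lam mu ε a b i = 0) :
    IsLameSolution N r lam mu ε (background lam mu (a 0))
      (fun x => modeConst lam mu • layeredField N r (a 0) (coulombJump r b) x) := by
  refine ⟨⟨_, (h.hasWeakGradient_layered (a 0) (coulombJump r b)).const_smul (modeConst lam mu),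
    fun φ hφ hc => ?_⟩, ?_⟩
  · refine (h.integral_energyDensity_layered hb hd lam mu ε (modeConst lam mu) hφ hc).trans ?_
    rw [Finset.sum_eq_zero fun i hi => by rw [ht i (Finset.mem_range.1 hi), zero_mul], mul_zero]
  -- Outside the structure the perturbation is exactly b₀ times the mode constant times x/|x|³,
  -- whose norm is this constant times |x|⁻².
  · refine IsBigO.of_bound ‖b 0 * modeConst lam mu‖ ?_
    have hfar : ∀ᶠ x : Space in cocompact Space, r 1 < ‖x‖ :=
      tendsto_norm_cocompact_atTop.eventually (eventually_gt_atTop (r 1))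
    filter_upwards [hfar] with x hx
    have hx0 : x ∈ layer N r 0 := by simpa [layer] using hx
    have hpos : 0 < ‖x‖ := (h.pos 1 le_rfl h.one_le).trans hx
    have : modeConst lam mu • layeredField N r (a 0) (coulombJump r b) x -
        background lam mu (a 0) x =
        (b 0 * modeConst lam mu * (((‖x‖ ^ 3)⁻¹ : ℝ) : ℂ)) • complexify x := by
      rw [h.smul_layeredField_eq hb hd (Nat.zero_le _) hx0, background_eq, uniformMode_eq]
      module
    rw [this, norm_smul, norm_mul, norm_complexify, Complex.norm_real, mul_assoc]
    refine mul_le_mul_of_nonneg_left (le_of_eq ?_) (norm_nonneg _)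
    rw [Real.norm_of_nonneg (by positivity), Real.norm_of_nonneg (by positivity)]
    field_simp

/-- A smooth radial profile supported away from the origin. -/
theorem exists_bump {s δ : ℝ} (hδ : 0 < δ) (hδs : δ < s) : ∃ η : ℝ → ℝ, ContDiff ℝ ∞ η ∧
    HasCompactSupport η ∧ tsupport η ⊆ Set.Ioi 0 ∧ η s = 1 ∧ (∀ t, |η t| ≤ 1) ∧
    ∀ t, δ ≤ |t - s| → η t = 0 := by
  let f : ContDiffBump s := ⟨δ / 2, δ, by positivity, by linarith⟩
  refine ⟨f, f.contDiff, f.hasCompactSupport, ?_, f.one_of_mem_closedBall (by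
    simpa using f.rIn_pos.le), fun t => by rw [abs_of_nonneg f.nonneg]; exact f.le_one,
    fun t ht => f.zero_of_le_dist (by simpa [Real.dist_eq] using ht)⟩
  rw [f.tsupport_eq]
  intro t ht
  have h1 : |t - s| ≤ δ := by simpa [Real.dist_eq] using ht
  have h2 := (abs_le.1 h1).1
  simp only [Set.mem_Ioi]
  linarith

theorem trace_jacobian_radialField {η : ℝ → ℝ} (hη : ContDiff ℝ ∞ η)
    (h0 : tsupport η ⊆ Set.Ioi 0) {x : Space} (hx : x ≠ 0) :
    (jacobian (radialField η) x).trace = ((3 * η ‖x‖ + deriv η ‖x‖ * ‖x‖ : ℝ) : ℂ) := by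
  rw [jacobian_radialField hη h0 hx, trace_complexMat, trace_radialGrad]

/-- The flux of a radial field through a sphere. -/
theorem integral_ball_divergence {η : ℝ → ℝ} (hη : ContDiff ℝ ∞ η) {s : ℝ} (hs : 0 < s) :
    ∫ x : Space, (if ‖x‖ ≤ s then ((3 * η ‖x‖ + deriv η ‖x‖ * ‖x‖ : ℝ) : ℂ) else 0) =
      sphereArea * ((s ^ 3 * η s : ℝ) : ℂ) := by
  rw [integral_comp_norm fun ρ => if ρ ≤ s then ((3 * η ρ + deriv η ρ * ρ : ℝ) : ℂ) else 0]
  congr 1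
  have h1 : ∀ ρ : ℝ, (ρ : ℂ) ^ 2 * (if ρ ≤ s then ((3 * η ρ + deriv η ρ * ρ : ℝ) : ℂ) else 0) =
      (Set.Iic s).indicator
        (fun ρ : ℝ => ((3 * ρ ^ 2 * η ρ + ρ ^ 3 * deriv η ρ : ℝ) : ℂ)) ρ := fun ρ => by
    by_cases h : ρ ≤ s
    · simp [h]
      ring
    · simp [h]
  simp only [h1]
  rw [setIntegral_indicator measurableSet_Iic, Set.Ioi_inter_Iic, integral_complex_ofReal,
    ← intervalIntegral.integral_of_le hs.le]
  congr 1
  -- The weight ρ² turns 3η + ρη' into the derivative of ρ³ η, which is the divergence theorem for a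
  -- radial field.
  have hder : ∀ ρ ∈ Set.uIcc 0 s, HasDerivAt (fun ρ => ρ ^ 3 * η ρ)
      (3 * ρ ^ 2 * η ρ + ρ ^ 3 * deriv η ρ) ρ := fun ρ _ => by
    exact ((hasDerivAt_pow 3 ρ).mul ((hη.differentiable (by simp)) ρ).hasDerivAt).congr_deriv
      (by norm_num)
  have hcont : Continuous fun ρ => 3 * ρ ^ 2 * η ρ + ρ ^ 3 * deriv η ρ := by
    have h1 := hη.continuous
    have h2 := hη.continuous_deriv (by simp)
    fun_prop
  rw [intervalIntegral.integral_eq_sub_of_hasDerivAt hder (hcont.intervalIntegrable _ _)]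
  simp

/-- The interfaces are separated from each other and from the origin. -/
theorem IsRadii.eventually_separated (h : IsRadii N r) {k : ℕ} (hk : k < N) :
    ∀ᶠ δ in nhdsWithin (0 : ℝ) (Set.Ioi 0),
      δ < r (k + 1) ∧ ∀ i < N, i ≠ k → δ ≤ |r (i + 1) - r (k + 1)| := by
  have key : ∀ c : ℝ, 0 < c → ∀ᶠ δ in nhdsWithin (0 : ℝ) (Set.Ioi 0), δ < c := fun c hc =>
    eventually_nhdsWithin_of_eventually_nhds (gt_mem_nhds hc)
  refine (key _ (h.pos_succ hk)).and ?_
  have : ∀ᶠ δ in nhdsWithin (0 : ℝ) (Set.Ioi 0), ∀ i ∈ Finset.range N, i ≠ k →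
      δ ≤ |r (i + 1) - r (k + 1)| := by
    rw [Filter.eventually_all_finset]
    intro i hi
    rcases eq_or_ne i k with rfl | hik
    · simp
    have hi' := Finset.mem_range.1 hi
    have hne : r (i + 1) - r (k + 1) ≠ 0 := by
      rcases lt_or_gt_of_ne hik with hlt | hlt
      · exact (sub_pos.2 (h.lt_of_lt (by omega) (by omega) (by omega))).ne'
      · exact (sub_neg.2 (h.lt_of_lt (by omega) (by omega) (by omega))).ne
    filter_upwards [key _ (abs_pos.2 hne)] with δ hδ _ using hδ.le
  simpa using this

/-- The weak equation forces continuity of the traction. -/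
theorem IsRadii.tractionDefect_eq_zero (h : IsRadii N r) (hb : b N = 0)
    (hd : ∀ i < N, fieldDefect r a b i = 0) {c : ℂ} (hc0 : c ≠ 0)
    (heq : ∀ φ : Space → Displacement, ContDiff ℝ ∞ φ → HasCompactSupport φ →
      ∫ x, energyDensity (coeff N r ε x * lam) (coeff N r ε x * mu)
        (c • layeredGrad N r (a 0) (coulombJump r b) x) (jacobian φ x) = 0) :
    ∀ i < N, tractionDefect r lam mu ε a b i = 0 := by
  intro k hk
  -- With δ below the distance to the other interfaces, the bump is 1 at r_{k+1} and 0 at every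
  -- other radius, so a single term of the sum survives.
  obtain ⟨δ, ⟨hδr, hδi⟩, hδ⟩ := ((h.eventually_separated hk).and self_mem_nhdsWithin).exists
  obtain ⟨η, hη, hηc, hη0, hη1, -, hηs⟩ := exists_bump hδ hδr
  have hφ := contDiff_radialField hη hη0
  have hφc := hasCompactSupport_radialField hηc
  have h1 := heq _ hφ hφc
  rw [h.integral_energyDensity_layered hb hd lam mu ε c hφ hφc, mul_eq_zero,
    or_iff_right hc0] at h1
  have h2 : ∀ i < N, ∫ x, (if ‖x‖ ≤ r (i + 1) then (jacobian (radialField η) x).trace else 0) =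
      sphereArea * ((r (i + 1) ^ 3 * η (r (i + 1)) : ℝ) : ℂ) := fun i hi => by
    rw [← integral_ball_divergence hη (h.pos_succ hi)]
    refine integral_congr_ae ?_
    filter_upwards [ae_ne_zero] with x hx
    rw [trace_jacobian_radialField hη hη0 hx]
  rw [Finset.sum_eq_single k] at h1
  · rw [h2 k hk, hη1, mul_eq_zero] at h1
    refine h1.resolve_right ?_
    have := sphereArea_pos.ne'
    have := (h.pos_succ hk).ne'
    simp [*]
  · intro i hi hik
    rw [h2 i (Finset.mem_range.1 hi), hηs _ (hδi i (Finset.mem_range.1 hi) hik)]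
    simp
  · simp [hk]

end

/-! ### Necessity of continuity across the interfaces. -/

section

variable {N : ℕ} {r : ℕ → ℝ} {lam mu : ℝ} {ε a b : ℕ → ℂ}

theorem fderiv_comp_norm_apply {η : ℝ → ℝ} (hη : ContDiff ℝ ∞ η) {x : Space} (hx : x ≠ 0)
    (i : Fin 3) :
    fderiv ℝ (fun y : Space => (η ‖y‖ : ℂ)) x (basisVec i) =
      ((deriv η ‖x‖ * (x i / ‖x‖) : ℝ) : ℂ) := by
  have h1 := ((hη.differentiable (by simp)) ‖x‖).hasDerivAt.comp_hasFDerivAt x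
    (hasFDerivAt_norm_of_ne_zero hx)
  have h2 : HasFDerivAt (fun y : Space => (η ‖y‖ : ℂ))
      (Complex.ofRealCLM.comp (deriv η ‖x‖ • ‖x‖⁻¹ • innerSL ℝ x)) x :=
    Complex.ofRealCLM.hasFDerivAt.comp x h1
  rw [h2.fderiv]
  simp [basisVec, EuclideanSpace.inner_single_right]
  left
  ring

/-- Tests the diagonal weak derivatives with ψ = η(|x|) and sums: Σ x_i ∂_i ψ = |x| η'(|x|). -/
theorem HasWeakGradientH1Loc.integral_radial {z : Space → Displacement}
    {G : Space → Matrix (Fin 3) (Fin 3) ℂ} (h : HasWeakGradientH1Loc z G) {g : Space → ℂ}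
    (hz : ∀ᵐ x, z x = g x • complexify x) {η : ℝ → ℝ} (hη : ContDiff ℝ ∞ η)
    (hc : HasCompactSupport η) (h0 : tsupport η ⊆ Set.Ioi 0) :
    ∫ x, g x * ((deriv η ‖x‖ * ‖x‖ : ℝ) : ℂ) = - ∫ x, (G x).trace * (η ‖x‖ : ℂ) := by
  have hψ : ContDiff ℝ ∞ fun x : Space => (η ‖x‖ : ℂ) :=
    Complex.ofRealCLM.contDiff.comp (contDiff_comp_norm hη h0)
  have hψc : HasCompactSupport fun x : Space => (η ‖x‖ : ℂ) :=
    (hasCompactSupport_comp_norm hc).comp_left (g := fun y : ℝ => (y : ℂ)) rfl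
  have h1 : ∑ i, ∫ x, z x i * fderiv ℝ (fun x : Space => (η ‖x‖ : ℂ)) x (basisVec i) =
      ∑ i, - ∫ x, G x i i * (η ‖x‖ : ℂ) :=
    Finset.sum_congr rfl fun i _ => h.weak_deriv _ hψ hψc i i
  rw [Finset.sum_neg_distrib, ← integral_finsetSum, ← integral_finsetSum] at h1
  · simp only [Matrix.trace, Matrix.diag, Finset.sum_mul]
    rw [← h1]
    refine integral_congr_ae ?_
    filter_upwards [hz, ae_ne_zero] with x hx hx0
    have hne : ‖x‖ ≠ 0 := by simpa using hx0
    simp only [hx, fderiv_comp_norm_apply hη hx0, PiLp.smul_apply, smul_eq_mul]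
    have h2 : ∀ i, g x * complexify x i * ((deriv η ‖x‖ * (x i / ‖x‖) : ℝ) : ℂ) =
        g x * ((deriv η ‖x‖ / ‖x‖ * (x i * x i) : ℝ) : ℂ) := fun i => by
      simp only [complexify]
      push_cast
      ring
    simp only [h2]
    rw [← Finset.mul_sum, ← Complex.ofReal_sum, ← Finset.mul_sum, sum_sq_eq_norm_sq]
    congr 2
    field_simp
  · exact fun i _ => integrable_mul_of_hasCompactSupport (h.locallyIntegrable_grad i i)
      hψ.continuous hψc
  · exact fun i _ => integrable_mul_of_hasCompactSupport (h.locallyIntegrable_field i)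
      (contDiff_fderiv_apply hψ _).continuous (hψc.fderiv_apply ℝ _)

/-- A locally integrable function carries no mass on a sphere: κ is bounded by the integral of |E|
over a shell of half-width δ, which tends to 0 by dominated convergence. -/
theorem eq_zero_of_forall_bump {E : Space → ℂ} (hE : LocallyIntegrable E) {s : ℝ} (hs : 0 < s)
    {κ : ℂ} (h : ∀ᶠ δ in nhdsWithin (0 : ℝ) (Set.Ioi 0), ∃ η : ℝ → ℝ, (∀ t, |η t| ≤ 1) ∧
      (∀ t, δ ≤ |t - s| → η t = 0) ∧ κ = ∫ x, E x * (η ‖x‖ : ℂ)) : κ = 0 := by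
  let S : ℝ → Set Space := fun δ => {x | |‖x‖ - s| < δ}
  have hSm : ∀ δ, MeasurableSet (S δ) := fun δ =>
    measurableSet_lt ((measurable_norm.sub_const s).abs) measurable_const
  have hint : Integrable ((S 1).indicator fun x => ‖E x‖) := by
    rw [integrable_indicator_iff (hSm 1)]
    refine IntegrableOn.mono_set
      (hE.integrableOn_isCompact (isCompact_closedBall (0 : Space) (s + 1))).norm ?_
    intro x hx
    have := (abs_lt.1 (show |‖x‖ - s| < 1 from hx)).2
    simp only [Metric.mem_closedBall, dist_zero_right]
    linarith
  have hsmall : ∀ᶠ δ in nhdsWithin (0 : ℝ) (Set.Ioi 0), δ < 1 :=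
    eventually_nhdsWithin_of_eventually_nhds (gt_mem_nhds one_pos)
  have htend : Tendsto (fun δ => ∫ x, (S δ).indicator (fun x => ‖E x‖) x)
      (nhdsWithin (0 : ℝ) (Set.Ioi 0)) (nhds (∫ _ : Space, (0 : ℝ))) := by
    refine tendsto_integral_filter_of_dominated_convergence ((S 1).indicator fun x => ‖E x‖)
      ?_ ?_ hint ?_
    · exact .of_forall fun δ => hE.aestronglyMeasurable.norm.indicator (hSm δ)
    · filter_upwards [hsmall] with δ hδ
      refine .of_forall fun x => ?_
      rw [Real.norm_of_nonneg (Set.indicator_nonneg (fun _ _ => norm_nonneg _) _)]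
      exact Set.indicator_le_indicator_of_subset (fun y (hy : _ < _) => hy.trans hδ)
        (fun _ => norm_nonneg _) x
    · filter_upwards [ae_norm_ne hs] with x hx
      refine tendsto_const_nhds.congr' ?_
      have : ∀ᶠ δ in nhdsWithin (0 : ℝ) (Set.Ioi 0), δ < |‖x‖ - s| :=
        eventually_nhdsWithin_of_eventually_nhds (gt_mem_nhds (abs_pos.2 (sub_ne_zero.2 hx)))
      filter_upwards [this] with δ hδ
      rw [Set.indicator_of_notMem]
      exact fun hmem : _ < _ => lt_asymm hmem hδ
  rw [integral_zero] at htend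
  have hle : ‖κ‖ ≤ 0 := by
    refine ge_of_tendsto htend ?_
    filter_upwards [h, hsmall] with δ ⟨η, h1, h2, h3⟩ hδ
    rw [h3]
    refine norm_integral_le_of_norm_le ?_ (.of_forall fun x => ?_)
    · refine hint.mono' (hE.aestronglyMeasurable.norm.indicator (hSm δ)) (.of_forall fun x => ?_)
      rw [Real.norm_of_nonneg (Set.indicator_nonneg (fun _ _ => norm_nonneg _) _)]
      exact Set.indicator_le_indicator_of_subset (fun y (hy : _ < _) => hy.trans hδ)
        (fun _ => norm_nonneg _) x
    · by_cases hx : x ∈ S δ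
      · rw [Set.indicator_of_mem hx, norm_mul, Complex.norm_real]
        exact mul_le_of_le_one_right (norm_nonneg _) (h1 _)
      · rw [Set.indicator_of_notMem hx, h2 _ (not_lt.1 hx)]
        simp
  exact norm_le_zero_iff.1 hle

/-- A layered field in `H¹_loc` is continuous across the interfaces. -/
theorem IsRadii.fieldDefect_eq_zero (h : IsRadii N r) (hb : b N = 0) {c : ℂ} (hc0 : c ≠ 0)
    {v : Space → Displacement} {G : Space → Matrix (Fin 3) (Fin 3) ℂ}
    (hv : HasWeakGradientH1Loc v G)
    (hlay : ∀ᵐ x, ∀ j ≤ N, x ∈ layer N r j →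
      v x = (c * (a j + b j * (((‖x‖ ^ 3)⁻¹ : ℝ) : ℂ))) • complexify x) :
    ∀ i < N, fieldDefect r a b i = 0 := by
  intro k hk
  have hz := hv.sub ((h.hasWeakGradient_layered (a 0) (coulombJump r b)).const_smul c)
  set z := v - c • layeredField N r (a 0) (coulombJump r b) with hzdef
  set D := G - c • layeredGrad N r (a 0) (coulombJump r b) with hDdef
  let g : Space → ℂ := fun x => ∑ i ∈ Finset.range N,
    if ‖x‖ ≤ r (i + 1) then c * fieldDefect r a b i else 0
  have hzg : ∀ᵐ x, z x = g x • complexify x := by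
    filter_upwards [hlay] with x hx
    obtain ⟨j, hj, hxj⟩ := h.exists_mem_layer x
    have h1 := h.field_eq (a := a) hb hj hxj
    rw [hzdef, Pi.sub_apply, Pi.smul_apply, hx j hj hxj, mul_smul, h1, smul_add, add_sub_cancel_left,
      ← Finset.sum_smul, smul_smul, Finset.mul_sum]
    simp only [g, mul_ite, mul_zero]
  have hball : ∀ s : ℝ, MeasurableSet {x : Space | ‖x‖ ≤ s} := fun s =>
    measurableSet_le measurable_norm measurable_const
  have hgm : LocallyIntegrable g := by
    refine locallyIntegrable_finsetSum _ fun i _ => ?_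
    exact ((continuous_const (y := c * fieldDefect r a b i)).locallyIntegrable).indicator
      (hball (r (i + 1)))
  have htr : LocallyIntegrable fun x => (D x).trace :=
    locallyIntegrable_finsetSum _ fun i _ => hz.locallyIntegrable_grad i i
  -- Formally ∇·(g x) = 3g + |x| ∂g/∂|x|, so 3g - tr D is minus the radial derivative term, a
  -- surface measure at the jumps of g. Since it is also locally integrable, the jumps vanish;
  -- below, pairing it with η yields the flux at one interface.
  have hE : LocallyIntegrable fun x => 3 * g x - (D x).trace := (hgm.smul (3 : ℂ)).sub htr
  have hrk := h.pos_succ hk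
  have key : c * fieldDefect r a b k * (sphereArea * (r (k + 1) : ℂ) ^ 3) = 0 := by
    refine eq_zero_of_forall_bump hE hrk ?_
    filter_upwards [h.eventually_separated hk, self_mem_nhdsWithin] with δ hδ hδ0
    obtain ⟨η, hη, hηc, hη0, hη1, hηle, hηs⟩ := exists_bump hδ0 hδ.1
    refine ⟨η, hηle, hηs, ?_⟩
    have h1 := hz.integral_radial hzg hη hηc hη0
    have hψ : Continuous fun x : Space => (η ‖x‖ : ℂ) :=
      Complex.continuous_ofReal.comp (hη.continuous.comp continuous_norm)
    have hψc : HasCompactSupport fun x : Space => (η ‖x‖ : ℂ) :=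
      (hasCompactSupport_comp_norm hηc).comp_left (g := fun y : ℝ => (y : ℂ)) rfl
    have hχ : Continuous fun x : Space => ((deriv η ‖x‖ * ‖x‖ : ℝ) : ℂ) :=
      Complex.continuous_ofReal.comp
        (((hη.continuous_deriv (by simp)).comp continuous_norm).mul continuous_norm)
    have hχc : HasCompactSupport fun x : Space => ((deriv η ‖x‖ * ‖x‖ : ℝ) : ℂ) :=
      ((hasCompactSupport_comp_norm hηc.deriv).mul_right).comp_left
        (g := fun y : ℝ => (y : ℂ)) rfl
    have i1 := integrable_mul_of_hasCompactSupport hgm hψ hψc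
    have i2 := integrable_mul_of_hasCompactSupport hgm hχ hχc
    have i3 := integrable_mul_of_hasCompactSupport htr hψ hψc
    have h2 : ∫ x, (3 * g x - (D x).trace) * (η ‖x‖ : ℂ) =
        ∫ x, g x * ((3 * η ‖x‖ + deriv η ‖x‖ * ‖x‖ : ℝ) : ℂ) := by
      have e1 : ∀ x : Space, (3 * g x - (D x).trace) * (η ‖x‖ : ℂ) =
          3 * (g x * (η ‖x‖ : ℂ)) - (D x).trace * (η ‖x‖ : ℂ) := fun x => by ring
      have e2 : ∀ x : Space, g x * ((3 * η ‖x‖ + deriv η ‖x‖ * ‖x‖ : ℝ) : ℂ) =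
          3 * (g x * (η ‖x‖ : ℂ)) + g x * ((deriv η ‖x‖ * ‖x‖ : ℝ) : ℂ) := fun x => by
        push_cast
        ring
      simp only [e1, e2]
      rw [integral_sub (i1.const_mul 3) i3, integral_add (i1.const_mul 3) i2, h1, sub_eq_add_neg]
    have i4 : Integrable fun x : Space => ((3 * η ‖x‖ + deriv η ‖x‖ * ‖x‖ : ℝ) : ℂ) := by
      refine (((hψ.integrable_of_hasCompactSupport hψc).const_mul 3).add
        (hχ.integrable_of_hasCompactSupport hχc)).congr (.of_forall fun x => ?_)
      simp
    have h3 : ∫ x, g x * ((3 * η ‖x‖ + deriv η ‖x‖ * ‖x‖ : ℝ) : ℂ) =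
        ∑ i ∈ Finset.range N, c * fieldDefect r a b i *
          (sphereArea * ((r (i + 1) ^ 3 * η (r (i + 1)) : ℝ) : ℂ)) := by
      have e1 : ∀ x : Space, g x * ((3 * η ‖x‖ + deriv η ‖x‖ * ‖x‖ : ℝ) : ℂ) =
          ∑ i ∈ Finset.range N, c * fieldDefect r a b i *
            (if ‖x‖ ≤ r (i + 1) then ((3 * η ‖x‖ + deriv η ‖x‖ * ‖x‖ : ℝ) : ℂ) else 0) :=
        fun x => by
          rw [Finset.sum_mul]
          exact Finset.sum_congr rfl fun i _ => by split_ifs <;> ring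
      simp only [e1]
      rw [integral_finsetSum]
      · refine Finset.sum_congr rfl fun i hi => ?_
        rw [integral_const_mul, integral_ball_divergence hη (h.pos_succ (Finset.mem_range.1 hi))]
      · exact fun i _ => (i4.indicator (hball (r (i + 1)))).const_mul _
    rw [h2, h3, Finset.sum_eq_single k]
    · simp [hη1]
    · intro i hi hik
      rw [hηs _ (hδ.2 i (Finset.mem_range.1 hi) hik)]
      simp
    · simp [hk]
  have hne : (sphereArea * (r (k + 1) : ℂ) ^ 3) ≠ 0 := by
    have := sphereArea_pos.ne'
    have := hrk.ne'
    simp [*]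
  exact ((mul_eq_zero.1 ((mul_eq_zero.1 key).resolve_right hne)).resolve_left hc0)

/-- The transmission conditions for a weak solution of layered form. -/
theorem IsRadii.transmission (h : IsRadii N r) (hb : b N = 0) {c : ℂ} (hc0 : c ≠ 0)
    {v : Space → Displacement} {G : Space → Matrix (Fin 3) (Fin 3) ℂ}
    (hv : HasWeakGradientH1Loc v G)
    (heq : ∀ φ : Space → Displacement, ContDiff ℝ ∞ φ → HasCompactSupport φ →
      ∫ x, energyDensity (coeff N r ε x * lam) (coeff N r ε x * mu) (G x) (jacobian φ x) = 0)
    (hlay : ∀ᵐ x, ∀ j ≤ N, x ∈ layer N r j →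
      v x = (c * (a j + b j * (((‖x‖ ^ 3)⁻¹ : ℝ) : ℂ))) • complexify x) :
    (∀ i < N, fieldDefect r a b i = 0) ∧ ∀ i < N, tractionDefect r lam mu ε a b i = 0 := by
  have hd := h.fieldDefect_eq_zero hb hc0 hv hlay
  refine ⟨hd, h.tractionDefect_eq_zero hb hd hc0 fun φ hφ hc => ?_⟩
  have hveq : c • layeredField N r (a 0) (coulombJump r b) =ᵐ[volume] v := by
    filter_upwards [hlay] with x hx
    obtain ⟨j, hj, hxj⟩ := h.exists_mem_layer x
    have h1 := h.field_eq (a := a) hb hj hxj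
    -- Continuity removes the step function, so v is the canonical layered field almost everywhere,
    -- and uniqueness of weak gradients lets the explicit gradient replace G.
    rw [hx j hj hxj, mul_smul, h1, Finset.sum_eq_zero fun i hi => by
      simp [hd i (Finset.mem_range.1 hi)], add_zero, Pi.smul_apply]
  have hG := (((h.hasWeakGradient_layered (a 0) (coulombJump r b)).const_smul c).congr_field
    hveq).ae_unique hv
  rw [← heq φ hφ hc]
  refine integral_congr_ae ?_
  filter_upwards [hG] with x hx
  rw [← hx]
  rfl

end

/-! ### One-dimensional distributional equations. -/

/-- Mean zero makes the primitive vanish past the support of g, and order connectedness of I keeps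
the interval between the extreme points of that support inside I. -/
theorem exists_primitive {I : Set ℝ} (hI : I.OrdConnected) {g : ℝ → ℝ} (hg : ContDiff ℝ ∞ g)
    (hc : HasCompactSupport g) (hgI : tsupport g ⊆ I) (h0 : ∫ t, g t = 0) :
    ∃ η : ℝ → ℝ, ContDiff ℝ ∞ η ∧ HasCompactSupport η ∧ tsupport η ⊆ I ∧ deriv η = g := by
  rcases (tsupport g).eq_empty_or_nonempty with he | hne
  · have : g = 0 := tsupport_eq_empty_iff.1 he
    subst this
    exact ⟨0, contDiff_const, HasCompactSupport.zero, by simp [tsupport_eq_empty_iff.2 rfl],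
      by simp⟩
  have hK : IsCompact (tsupport g) := hc
  set m := sInf (tsupport g) with hm
  set M := sSup (tsupport g) with hM
  have hmI : m ∈ I := hgI (hK.sInf_mem hne)
  have hMI : M ∈ I := hgI (hK.sSup_mem hne)
  have hlow : ∀ t, t < m → g t = 0 := fun t ht => by
    by_contra hgt
    exact absurd (csInf_le hK.bddBelow (subset_tsupport g hgt)) (not_le.2 ht)
  have hupp : ∀ t, M < t → g t = 0 := fun t ht => by
    by_contra hgt
    exact absurd (le_csSup hK.bddAbove (subset_tsupport g hgt)) (not_le.2 ht)
  -- The base point m - 1 lies strictly to the left of the support of g.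
  have hder : ∀ t, HasDerivAt (fun t => ∫ s in (m - 1)..t, g s) (g t) t := fun t =>
    hg.continuous.integral_hasStrictDerivAt (m - 1) t |>.hasDerivAt
  have hderiv : deriv (fun t => ∫ s in (m - 1)..t, g s) = g := funext fun t => (hder t).deriv
  have hsupp : ∀ t, t ∉ Set.Icc m M → ∫ s in (m - 1)..t, g s = 0 := by
    intro t ht
    by_cases htm : t < m
    · rw [intervalIntegral.integral_congr (g := fun _ => 0)]
      · simp
      · intro s hs
        refine hlow s (lt_of_le_of_lt hs.2 ?_)
        simp [htm]
    · have htM : M < t := by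
        by_contra hle
        exact ht ⟨not_lt.1 htm, not_lt.1 hle⟩
      rw [intervalIntegral.integral_eq_integral_of_support_subset, h0]
      intro s hs
      constructor
      · by_contra hle
        exact hs (hlow s (by linarith [not_lt.1 hle]))
      · by_contra hle
        exact hs (hupp s (htM.trans (not_le.1 hle)))
  have hts : tsupport (fun t => ∫ s in (m - 1)..t, g s) ⊆ Set.Icc m M := by
    refine closure_minimal (fun t ht => ?_) isClosed_Icc
    by_contra hmem
    exact ht (hsupp t hmem)
  refine ⟨fun t => ∫ s in (m - 1)..t, g s, ?_, ?_, hts.trans (hI.out hmI hMI), hderiv⟩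
  · rw [contDiff_infty_iff_deriv, hderiv]
    exact ⟨fun t => (hder t).differentiableAt, hg⟩
  · exact isCompact_Icc.of_isClosed_subset (isClosed_tsupport _) hts

/-- A normalized test function, for a weight that is positive on the given open set. -/
theorem exists_test_integral_eq_one {I : Set ℝ} (hI : IsOpen I) (hne : I.Nonempty) {w : ℝ → ℝ}
    (hw : Continuous w) (hwI : ∀ t ∈ I, 0 < w t) :
    ∃ g : ℝ → ℝ, ContDiff ℝ ∞ g ∧ HasCompactSupport g ∧ tsupport g ⊆ I ∧ ∫ t, w t * g t = 1 := by
  obtain ⟨s, hs⟩ := hne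
  obtain ⟨g, hgI, hgc, hg, hrange, hgs⟩ := exists_contDiff_tsupport_subset (n := ⊤)
    (hI.mem_nhds hs)
  have hg0 : ∀ t, 0 ≤ g t := fun t => (hrange ⟨t, rfl⟩).1
  have hpos : 0 < ∫ t, w t * g t := by
    refine Continuous.integral_pos_of_hasCompactSupport_nonneg_nonzero (x := s)
      (hw.mul hg.continuous) hgc.mul_left (fun t => ?_) ?_
    · by_cases ht : t ∈ I
      · exact mul_nonneg (hwI t ht).le (hg0 t)
      · simp [image_eq_zero_of_notMem_tsupport fun h => ht (hgI h)]
    · simp [hgs, (hwI s hs).ne']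
  refine ⟨fun t => (∫ t, w t * g t)⁻¹ * g t, contDiff_const.mul hg, hgc.mul_left,
    (tsupport_mul_subset_right).trans hgI, ?_⟩
  have : ∀ t, w t * ((∫ t, w t * g t)⁻¹ * g t) = (∫ t, w t * g t)⁻¹ * (w t * g t) := fun t => by
    ring
  simp only [this]
  rw [integral_const_mul, inv_mul_cancel₀ hpos.ne']

/-- A linear functional that vanishes on the test functions of weighted mean zero is a multiple of
the weighted mean. -/
theorem integral_eq_of_weighted_mean {I : Set ℝ} (hI : IsOpen I) (hne : I.Nonempty) {w : ℝ → ℝ}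
    (hw : Continuous w) (hwI : ∀ t ∈ I, 0 < w t) (Λ : (ℝ → ℝ) → ℂ)
    (hΛ : ∀ g θ : ℝ → ℝ, ∀ c : ℝ, ContDiff ℝ ∞ g → HasCompactSupport g → ContDiff ℝ ∞ θ →
      HasCompactSupport θ → Λ (fun t => g t - c * θ t) = Λ g - c * Λ θ)
    (h : ∀ g : ℝ → ℝ, ContDiff ℝ ∞ g → HasCompactSupport g → tsupport g ⊆ I →
      ∫ t, w t * g t = 0 → Λ g = 0) :
    ∃ C : ℂ, ∀ g : ℝ → ℝ, ContDiff ℝ ∞ g → HasCompactSupport g → tsupport g ⊆ I →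
      Λ g = (∫ t, w t * g t : ℝ) * C := by
  obtain ⟨θ, hθ, hθc, hθI, hθ1⟩ := exists_test_integral_eq_one hI hne hw hwI
  refine ⟨Λ θ, fun g hg hgc hgI => ?_⟩
  rw [← sub_eq_zero, ← hΛ g θ _ hg hgc hθ hθc]
  refine h _ (hg.sub (contDiff_const.mul hθ)) (hgc.sub hθc.mul_left) ?_ ?_
  · exact (tsupport_sub g fun t => (∫ t, w t * g t) * θ t).trans
      (Set.union_subset hgI ((tsupport_mul_subset_right).trans hθI))
  · have e : ∀ t, w t * (g t - (∫ t, w t * g t) * θ t) =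
        w t * g t - (∫ t, w t * g t) * (w t * θ t) := fun t => by ring
    simp only [e]
    rw [integral_sub, integral_const_mul, hθ1, mul_one, sub_self]
    · exact (hw.mul hg.continuous).integrable_of_hasCompactSupport hgc.mul_left
    · exact ((hw.mul hθ.continuous).integrable_of_hasCompactSupport hθc.mul_left).const_mul _

theorem integrable_ofReal_mul {F : ℝ → ℂ} (hF : LocallyIntegrable F) {g : ℝ → ℝ}
    (hg : Continuous g) (hc : HasCompactSupport g) : Integrable fun t => (g t : ℂ) * F t := by
  simpa using hF.integrable_smul_left_of_hasCompactSupport hg hc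

/-- The lemma of du Bois-Reymond. -/
theorem ae_eq_const_of_integral_deriv {I : Set ℝ} (hI : IsOpen I) (hne : I.Nonempty)
    (hord : I.OrdConnected) {F : ℝ → ℂ} (hF : LocallyIntegrable F)
    (h : ∀ g : ℝ → ℝ, ContDiff ℝ ∞ g → HasCompactSupport g → tsupport g ⊆ I →
      ∫ t, ((deriv g t : ℝ) : ℂ) * F t = 0) :
    ∃ C : ℂ, ∀ᵐ t, t ∈ I → F t = C := by
  obtain ⟨C, hC⟩ := integral_eq_of_weighted_mean hI hne (w := fun _ => 1) continuous_const
    (fun _ _ => one_pos) (fun g => ∫ t, (g t : ℂ) * F t) (fun g θ c hg hgc hθ hθc => by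
      have e : ∀ t, ((g t - c * θ t : ℝ) : ℂ) * F t = g t * F t - c * (θ t * F t) := fun t => by
        push_cast
        ring
      simp only [e]
      rw [integral_sub (integrable_ofReal_mul hF hg.continuous hgc)
        ((integrable_ofReal_mul hF hθ.continuous hθc).const_mul _), integral_const_mul])
    (fun g hg hgc hgI h0 => by
      obtain ⟨η, hη, hηc, hηI, hηg⟩ := exists_primitive hord hg hgc hgI (by simpa using h0)
      simpa [hηg] using h η hη hηc hηI)
  refine ⟨C, ?_⟩
  have := hI.ae_eq_zero_of_integral_contDiff_smul_eq_zero (μ := volume) (f := fun t => F t - C)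
    ((hF.sub (continuous_const.locallyIntegrable)).locallyIntegrableOn I)
    (fun g hg hgc hgI => by
      have i1 := integrable_ofReal_mul hF hg.continuous hgc
      have i2 : Integrable fun t => (g t : ℂ) * C :=
        (hg.continuous.integrable_of_hasCompactSupport hgc).ofReal.mul_const C
      simp only [Complex.real_smul, mul_sub]
      rw [integral_sub i1 i2, integral_mul_const, hC g hg hgc hgI, integral_complex_ofReal]
      simp)
  filter_upwards [this] with t ht htI using sub_eq_zero.1 (ht htI)

/-- The radial equidimensional equation of second order, in the sense of distributions. -/
theorem ae_eq_cubic_of_integral_deriv {I : Set ℝ} (hI : IsOpen I) (hne : I.Nonempty)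
    (hord : I.OrdConnected) (hpos : I ⊆ Set.Ioi 0) {F : ℝ → ℂ} (hF : LocallyIntegrable F)
    (h : ∀ g : ℝ → ℝ, ContDiff ℝ ∞ g → HasCompactSupport g → tsupport g ⊆ I →
      ∫ t, t ^ 2 * g t = 0 → ∫ t, ((deriv g t : ℝ) : ℂ) * F t = 0) :
    ∃ A B : ℂ, ∀ᵐ t, t ∈ I → F t = A * (t : ℂ) ^ 3 + B := by
  have hint : ∀ {g : ℝ → ℝ}, ContDiff ℝ ∞ g → HasCompactSupport g →
      Integrable fun t => ((deriv g t : ℝ) : ℂ) * F t := fun hg hgc =>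
    integrable_ofReal_mul hF (hg.continuous_deriv (by simp)) hgc.deriv
  obtain ⟨C, hC⟩ := integral_eq_of_weighted_mean hI hne (w := fun t => t ^ 2) (by fun_prop)
    (fun t ht => by have := hpos ht; simp only [Set.mem_Ioi] at this; positivity)
    (fun g => ∫ t, ((deriv g t : ℝ) : ℂ) * F t) (fun g θ c hg hgc hθ hθc => by
      have e : ∀ t, ((deriv (fun t => g t - c * θ t) t : ℝ) : ℂ) * F t =
          (deriv g t : ℝ) * F t - c * ((deriv θ t : ℝ) * F t) := fun t => by
        have h1 := ((hg.differentiable (by simp)) t).hasDerivAt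
        have h2 := ((hθ.differentiable (by simp)) t).hasDerivAt
        have h3 : HasDerivAt (fun t => g t - c * θ t) (deriv g t - c * deriv θ t) t :=
          h1.sub (h2.const_mul c)
        rw [h3.deriv]
        push_cast
        ring
      simp only [e]
      rw [integral_sub (hint hg hgc) ((hint hθ hθc).const_mul _), integral_const_mul]) h
  -- By parts, ∫ t³ g' = -3 ∫ t² g, so this cubic cancels the multiple C ∫ t² g and leaves the
  -- hypothesis of the du Bois-Reymond lemma.
  have hF' : LocallyIntegrable fun t : ℝ => F t + C / 3 * (t : ℂ) ^ 3 :=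
    hF.add (Continuous.locallyIntegrable (by fun_prop))
  obtain ⟨B, hB⟩ := ae_eq_const_of_integral_deriv hI hne hord hF' (fun g hg hgc hgI => by
    have hd : Continuous (deriv g) := hg.continuous_deriv (by simp)
    have hparts : ∫ t, t ^ 3 * deriv g t = - ∫ t, 3 * t ^ 2 * g t := by
      refine integral_mul_deriv_eq_deriv_mul_of_integrable (u := fun t => t ^ 3)
        (fun t _ => by simpa using hasDerivAt_pow 3 t)
        (fun t _ => ((hg.differentiable (by simp)) t).hasDerivAt) ?_ ?_ ?_
      · exact Continuous.integrable_of_hasCompactSupport (by fun_prop) hgc.deriv.mul_left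
      · exact Continuous.integrable_of_hasCompactSupport
          (Continuous.mul (by fun_prop) hg.continuous) hgc.mul_left
      · exact Continuous.integrable_of_hasCompactSupport
          (Continuous.mul (by fun_prop) hg.continuous) hgc.mul_left
    have e : ∀ t, ((deriv g t : ℝ) : ℂ) * (F t + C / 3 * (t : ℂ) ^ 3) =
        (deriv g t : ℝ) * F t + C / 3 * ((t ^ 3 * deriv g t : ℝ) : ℂ) := fun t => by
      push_cast
      ring
    have i2 : Integrable fun t => ((t ^ 3 * deriv g t : ℝ) : ℂ) :=
      (Continuous.integrable_of_hasCompactSupport (by fun_prop) hgc.deriv.mul_left).ofReal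
    simp only [e]
    rw [integral_add (hint hg hgc) (i2.const_mul _), integral_const_mul, integral_complex_ofReal,
      hparts, hC g hg hgc hgI]
    simp only [mul_assoc]
    rw [integral_const_mul]
    push_cast
    ring)
  refine ⟨-C / 3, B, ?_⟩
  filter_upwards [hB] with t ht htI
  rw [← ht htI]
  ring

/-- Integrates the indicator of the failure of Q in polar coordinates. Since it vanishes almost
everywhere, no measurability of Q is needed. -/
theorem ae_comp_norm {Q : ℝ → Prop} (h : ∀ᵐ ρ, Q ρ) : ∀ᵐ x : Space, Q ‖x‖ := by
  classical
  let f : ℝ → ℝ := fun ρ => if Q ρ then 0 else 1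
  have hf : f =ᵐ[volume] 0 := by
    filter_upwards [h] with ρ hρ
    simp [f, hρ]
  have h0 : (fun y : ℝ => y ^ (Module.finrank ℝ Space - 1) • f y) =ᵐ[volume.restrict (Set.Ioi 0)]
      0 := by
    filter_upwards [ae_restrict_of_ae hf] with ρ hρ
    simp [hρ]
  have hint : Integrable fun x : Space => f ‖x‖ := by
    rw [integrable_fun_norm_addHaar volume]
    exact (integrable_zero _ _ _).congr h0.symm
  have hzero : ∫ x : Space, f ‖x‖ = 0 := by
    rw [integral_fun_norm_addHaar volume f, integral_congr_ae h0]
    simp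
  have hnn : ∀ x : Space, 0 ≤ f ‖x‖ := fun x => by
    simp only [f]
    split_ifs <;> simp
  rw [integral_eq_zero_iff_of_nonneg hnn hint] at hzero
  filter_upwards [hzero] with x hx
  by_contra hq
  simp [f, hq] at hx

/-! ### Spherically symmetric solutions inside one layer. -/

/-- The open interval of radii in the interior of the layer `D_j`. -/
def shell (N : ℕ) (r : ℕ → ℝ) (j : ℕ) : Set ℝ :=
  {ρ | 0 < ρ ∧ (j ≠ 0 → ρ < r j) ∧ (j ≠ N → r (j + 1) < ρ)}

theorem isOpen_shell (N : ℕ) (r : ℕ → ℝ) (j : ℕ) : IsOpen (shell N r j) := by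
  have h1 : IsOpen {ρ : ℝ | 0 < ρ} := isOpen_lt continuous_const continuous_id
  have h2 : IsOpen {ρ : ℝ | ρ < r j} := isOpen_lt continuous_id continuous_const
  have h3 : IsOpen {ρ : ℝ | r (j + 1) < ρ} := isOpen_lt continuous_const continuous_id
  have h2' : IsOpen {ρ : ℝ | j ≠ 0 → ρ < r j} := by
    by_cases h : j = 0
    · simp [h]
    · simpa [h] using h2
  have h3' : IsOpen {ρ : ℝ | j ≠ N → r (j + 1) < ρ} := by
    by_cases h : j = N
    · simp [h]
    · simpa [h] using h3
  exact h1.inter (h2'.inter h3')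

theorem ordConnected_shell (N : ℕ) (r : ℕ → ℝ) (j : ℕ) : (shell N r j).OrdConnected :=
  ⟨fun _ hx _ hy _ hz => ⟨hx.1.trans_le hz.1, fun h => hz.2.trans_lt (hy.2.1 h),
    fun h => (hx.2.2 h).trans_le hz.1⟩⟩

namespace IsRadii

variable {N : ℕ} {r : ℕ → ℝ} {lam mu : ℝ} {ε a b : ℕ → ℂ} {j : ℕ}

theorem shell_nonempty (h : IsRadii N r) (hj : j ≤ N) : (shell N r j).Nonempty := by
  have h1 := h.one_le
  rcases eq_or_ne j 0 with rfl | h0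
  · have := h.pos 1 le_rfl h1
    exact ⟨r 1 + 1, by linarith, fun h => absurd rfl h, fun _ => by simp⟩
  · rcases hj.eq_or_lt with rfl | hlt
    · have := h.pos j h1 le_rfl
      exact ⟨r j / 2, by linarith, fun _ => by linarith, fun h => absurd rfl h⟩
    · have h2 := h.pos_succ hlt
      have h3 := h.anti j (by omega) hlt
      exact ⟨(r j + r (j + 1)) / 2, by linarith, fun _ => by linarith, fun _ => by linarith⟩

theorem mem_layer_of_norm_mem_shell (h : IsRadii N r) (hj : j ≤ N) {x : Space}
    (hx : ‖x‖ ∈ shell N r j) : x ∈ layer N r j :=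
  (h.mem_layer_iff hj).2 ⟨fun h0 => (hx.2.1 h0).le, hx.2.2⟩

theorem ae_norm_mem_shell (h : IsRadii N r) :
    ∀ᵐ x : Space, ∀ j ≤ N, x ∈ layer N r j → ‖x‖ ∈ shell N r j := by
  have : ∀ᵐ x : Space, ∀ i ∈ Finset.range N, ‖x‖ ≠ r (i + 1) := by
    rw [eventually_all_finset]
    exact fun i hi => ae_norm_ne (h.pos_succ (Finset.mem_range.1 hi))
  filter_upwards [this, ae_ne_zero] with x hx hx0 j hj hxj
  rw [h.mem_layer_iff hj] at hxj
  refine ⟨norm_pos_iff.2 hx0, fun h0 => lt_of_le_of_ne (hxj.1 h0) ?_, hxj.2⟩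
  have := hx (j - 1) (Finset.mem_range.2 (by omega))
  rwa [Nat.sub_add_cancel (by omega)] at this

/-- The weak equation, tested with radial fields supported in one layer. -/
theorem integral_trace_mul_divergence_eq_zero (h : IsRadii N r) (hj : j ≤ N) (hεj : ε j ≠ 0)
    (hlm : 0 < lam + 2 * mu) {v : Space → Displacement} {G : Space → Matrix (Fin 3) (Fin 3) ℂ}
    (hv : HasWeakGradientH1Loc v G)
    (heq : ∀ φ : Space → Displacement, ContDiff ℝ ∞ φ → HasCompactSupport φ →
      ∫ x, energyDensity (coeff N r ε x * lam) (coeff N r ε x * mu) (G x) (jacobian φ x) = 0)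
    {η : ℝ → ℝ} (hη : ContDiff ℝ ∞ η) (hc : HasCompactSupport η) (hs : tsupport η ⊆ shell N r j) :
    ∫ x, (G x).trace * ((3 * η ‖x‖ + deriv η ‖x‖ * ‖x‖ : ℝ) : ℂ) = 0 := by
  have h0 : tsupport η ⊆ Set.Ioi 0 := fun t ht => (hs ht).1
  have hφ := contDiff_radialField hη h0
  have hφc := hasCompactSupport_radialField hc
  have h1 := heq _ hφ hφc
  have h2 : ∫ x, energyDensity (coeff N r ε x * lam) (coeff N r ε x * mu) (G x)
        (jacobian (radialField η) x) =
      ∫ x, (ε j * lam * ((G x).trace * (jacobian (radialField η) x).trace) +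
        2 * (ε j * mu) * (G x * jacobian (radialField η) x).trace) := by
    refine integral_congr_ae ?_
    filter_upwards [ae_ne_zero] with x hx
    have hJ := jacobian_radialField hη h0 hx
    rw [energyDensity_of_transpose_right (by rw [hJ, complexMat_transpose_radialGrad])]
    -- On the support of η the coefficient is the constant ε_j; off it the Jacobian vanishes and the
    -- coefficient does not matter.
    by_cases hmem : ‖x‖ ∈ tsupport η
    · rw [h.coeff_eq ε hj (h.mem_layer_of_norm_mem_shell hj (hs hmem))]
    · have hz : jacobian (radialField η) x = 0 := by
        rw [hJ, image_eq_zero_of_notMem_tsupport hmem,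
          image_eq_zero_of_notMem_tsupport fun h => hmem (tsupport_deriv_subset h)]
        ext i k
        simp [complexMat, radialGrad]
      simp [hz]
  rw [h2, integral_add ((hv.integrable_trace_mul_trace hφ hφc).const_mul _)
    ((hv.integrable_trace_mul hφ hφc).const_mul _), integral_const_mul, integral_const_mul,
    hv.integral_trace_mul hφ hφc] at h1
  -- Both invariants have the same integral, so the moduli combine to λ + 2μ.
  have h3 : ε j * (lam + 2 * mu) *
      ∫ x, (G x).trace * (jacobian (radialField η) x).trace = 0 := by
    linear_combination h1
  have hne : (lam + 2 * mu : ℂ) ≠ 0 := by exact_mod_cast hlm.ne'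
  rw [← (mul_eq_zero.1 h3).resolve_left (mul_ne_zero hεj hne)]
  refine integral_congr_ae ?_
  filter_upwards [ae_ne_zero] with x hx
  rw [trace_jacobian_radialField hη h0 hx]

end IsRadii

/-- The profile is recovered as f(|x|)|x| = Σ v_i x_i/|x|, and the polar weight ρ² gives ρ³ f down
to the origin. The indicator is needed because f is uncontrolled on negative arguments. -/
theorem locallyIntegrable_radial {v : Space → Displacement}
    {G : Space → Matrix (Fin 3) (Fin 3) ℂ} (hv : HasWeakGradientH1Loc v G) {f : ℝ → ℂ}
    (hf : ∀ᵐ x : Space, ∀ i, v x i = f ‖x‖ * (x i : ℂ)) :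
    LocallyIntegrable ((Set.Ioi 0).indicator fun ρ : ℝ => (ρ : ℂ) ^ 3 * f ρ) := by
  have hmul : ∀ i, LocallyIntegrable fun x : Space => v x i * ((x i / ‖x‖ : ℝ) : ℂ) := fun i => by
    intro x
    obtain ⟨s, hs, hint⟩ := hv.locallyIntegrable_field i x
    refine ⟨s, hs, hint.norm.mono' ?_ (.of_forall fun y => ?_)⟩
    · refine hint.aestronglyMeasurable.mul (Measurable.aestronglyMeasurable ?_)
      have : Measurable fun y : Space => y i :=
        (EuclideanSpace.proj i : Space →L[ℝ] ℝ).continuous.measurable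
      exact Complex.measurable_ofReal.comp (this.div measurable_norm)
    · rw [norm_mul, Complex.norm_real]
      refine mul_le_of_le_one_right (norm_nonneg _) ?_
      rw [norm_div, norm_norm]
      exact div_le_one_of_le₀ (PiLp.norm_apply_le y i) (norm_nonneg _)
  have hsum : LocallyIntegrable fun x : Space => ∑ i, v x i * ((x i / ‖x‖ : ℝ) : ℂ) :=
    locallyIntegrable_finsetSum _ fun i _ => hmul i
  have hloc : ∀ R : ℝ, IntegrableOn (fun x : Space => f ‖x‖ * (‖x‖ : ℂ)) (Metric.ball 0 R) := by
    intro R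
    refine ((hsum.integrableOn_isCompact (isCompact_closedBall (0 : Space) R)).mono_set
      Metric.ball_subset_closedBall).congr (ae_restrict_of_ae ?_)
    filter_upwards [hf, ae_ne_zero] with x hx hx0
    have hne : ‖x‖ ≠ 0 := by simpa using hx0
    have e : ∀ i, v x i * ((x i / ‖x‖ : ℝ) : ℂ) = f ‖x‖ * ((x i * x i / ‖x‖ : ℝ) : ℂ) := fun i => by
      rw [hx i]
      push_cast
      ring
    simp only [e]
    rw [← Finset.mul_sum, ← Complex.ofReal_sum, ← Finset.sum_div, sum_sq_eq_norm_sq]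
    congr 2
    field_simp
  rw [locallyIntegrable_iff]
  intro K hK
  obtain ⟨R, hR⟩ := hK.isBounded.subset_ball (0 : ℝ)
  have h1 := (integrableOn_fun_norm_addHaar volume (f := fun ρ : ℝ => f ρ * (ρ : ℂ))).1 (hloc R)
  have h2 : IntegrableOn (fun ρ : ℝ => (ρ : ℂ) ^ 3 * f ρ) (Set.Ioo 0 R) := by
    refine h1.congr_fun (fun ρ _ => ?_) measurableSet_Ioo
    simp
    ring
  have h3 : IntegrableOn ((Set.Ioi 0).indicator fun ρ : ℝ => (ρ : ℂ) ^ 3 * f ρ)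
      (Set.Iio R) := by
    rw [IntegrableOn, integrable_indicator_iff measurableSet_Ioi, IntegrableOn,
      Measure.restrict_restrict measurableSet_Ioi, Set.Ioi_inter_Iio]
    exact h2
  refine h3.mono_set fun t ht => ?_
  have := hR ht
  rw [Metric.mem_ball, dist_zero_right, Real.norm_eq_abs] at this
  exact (abs_lt.1 this).2

/-- Inside a layer, a spherically symmetric solution is a combination of the two radial modes. -/
theorem IsRadii.exists_modes (h : IsRadii N r) {lam mu : ℝ} {ε : ℕ → ℂ} {j : ℕ} (hj : j ≤ N)
    (hεj : ε j ≠ 0) (hlm : 0 < lam + 2 * mu) {v : Space → Displacement}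
    {G : Space → Matrix (Fin 3) (Fin 3) ℂ} (hv : HasWeakGradientH1Loc v G)
    (heq : ∀ φ : Space → Displacement, ContDiff ℝ ∞ φ → HasCompactSupport φ →
      ∫ x, energyDensity (coeff N r ε x * lam) (coeff N r ε x * mu) (G x) (jacobian φ x) = 0)
    {f : ℝ → ℂ} (hf : ∀ᵐ x : Space, ∀ i, v x i = f ‖x‖ * (x i : ℂ)) :
    ∃ A B : ℂ, ∀ᵐ x : Space, x ∈ layer N r j →
      v x = (A + B * (((‖x‖ ^ 3)⁻¹ : ℝ) : ℂ)) • complexify x := by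
  have hpos : shell N r j ⊆ Set.Ioi 0 := fun t ht => ht.1
  obtain ⟨A, B, hAB⟩ := ae_eq_cubic_of_integral_deriv (isOpen_shell N r j) (h.shell_nonempty hj)
    (ordConnected_shell N r j) hpos (locallyIntegrable_radial hv hf) (fun θ hθ hθc hθs hθ0 => by
      -- Solves ∇·(η(|x|) x) = θ(|x|), that is (t³ η)' = t² θ: take ζ a primitive of t² θ, compactly
      -- supported because of the weighted mean zero, and η = ζ/t³.
      obtain ⟨ζ, hζ, hζc, hζs, hζd⟩ := exists_primitive (ordConnected_shell N r j)
        ((contDiff_id.pow 2).mul hθ) hθc.mul_left (tsupport_mul_subset_right.trans hθs)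
        (by simpa using hθ0)
      let η : ℝ → ℝ := fun t => (t ^ 3)⁻¹ * ζ t
      have hηs : tsupport η ⊆ tsupport ζ := tsupport_mul_subset_right
      have hη : ContDiff ℝ ∞ η := by
        rw [contDiff_iff_contDiffAt]
        intro t
        rcases eq_or_ne t 0 with rfl | ht
        · have hz : (0 : ℝ) ∉ tsupport η := fun hm => lt_irrefl (0 : ℝ) (hpos (hζs (hηs hm)))
          rw [notMem_tsupport_iff_eventuallyEq] at hz
          exact (contDiffAt_const (c := (0 : ℝ))).congr_of_eventuallyEq hz
        · exact ((contDiff_id.pow 3).contDiffAt.inv (by simpa using ht)).mul hζ.contDiffAt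
      have hηθ : ∀ t, 3 * η t + deriv η t * t = θ t := by
        intro t
        rcases eq_or_ne t 0 with rfl | ht
        · have hz : (0 : ℝ) ∉ tsupport η := fun hm => lt_irrefl (0 : ℝ) (hpos (hζs (hηs hm)))
          have hz' : (0 : ℝ) ∉ tsupport θ := fun hm => lt_irrefl (0 : ℝ) (hpos (hθs hm))
          simp [image_eq_zero_of_notMem_tsupport hz, image_eq_zero_of_notMem_tsupport hz']
        · have h1 : HasDerivAt η (-(3 * t ^ 2) / (t ^ 3) ^ 2 * ζ t + (t ^ 3)⁻¹ * (t ^ 2 * θ t)) t := by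
            have hd := ((hζ.differentiable (by simp)) t).hasDerivAt
            rw [hζd] at hd
            have hp : HasDerivAt (fun t : ℝ => t ^ 3) (3 * t ^ 2) t := by
              simpa using hasDerivAt_pow 3 t
            exact (hp.fun_inv (by positivity)).mul hd
          rw [h1.deriv]
          simp only [η]
          field_simp
          ring
      have h1 := h.integral_trace_mul_divergence_eq_zero hj hεj hlm hv heq hη hζc.mul_left
        (hηs.trans hζs)
      simp only [hηθ] at h1
      have h2 := hv.integral_radial (g := fun x => f ‖x‖) (by
        filter_upwards [hf] with x hx
        ext i
        simp [hx i, complexify]) hθ hθc (hθs.trans hpos)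
      rw [h1, neg_zero, integral_comp_norm fun ρ => f ρ * ((deriv θ ρ * ρ : ℝ) : ℂ), mul_eq_zero,
        or_iff_right (by exact_mod_cast sphereArea_pos.ne')] at h2
      rw [← h2, ← integral_indicator measurableSet_Ioi]
      refine integral_congr_ae (.of_forall fun t => ?_)
      by_cases ht : t ∈ Set.Ioi (0 : ℝ)
      · simp only [Set.indicator_of_mem ht]
        push_cast
        ring
      · simp only [Set.indicator_of_notMem ht, mul_zero])
  refine ⟨A, B, ?_⟩
  filter_upwards [ae_comp_norm hAB, hf, h.ae_norm_mem_shell] with x hx hfx hsh hxj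
  have hmem := hsh j hj hxj
  have h1 := hx hmem
  have hne : (‖x‖ : ℂ) ≠ 0 := by exact_mod_cast hmem.1.ne'
  rw [Set.indicator_of_mem (hpos hmem)] at h1
  have h2 : f ‖x‖ = A + B * (((‖x‖ ^ 3)⁻¹ : ℝ) : ℂ) := by
    push_cast
    field_simp
    linear_combination h1
  ext i
  rw [hfx i, h2]
  simp [complexify]

/-! ### Conditions at the origin and at infinity. -/

/-- The field `x / |x|³` is not square integrable at the origin. -/
theorem decay_eq_zero_of_memLp {v : Space → Displacement} {s : ℝ} (hs : 0 < s) {A B : ℂ}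
    (hv : ∀ i, MemLp (fun x => v x i) 2 (volume.restrict (Metric.ball (0 : Space) s)))
    (hlay : ∀ᵐ x : Space, ‖x‖ ≤ s →
      v x = (A + B * (((‖x‖ ^ 3)⁻¹ : ℝ) : ℂ)) • complexify x) : B = 0 := by
  by_contra hB
  have : IsFiniteMeasure (volume.restrict (Metric.ball (0 : Space) s)) :=
    ⟨by simpa using measure_ball_lt_top (μ := volume) (x := (0 : Space)) (r := s)⟩
  have h1 : ∀ i, MemLp (fun x : Space => v x i - A * (x i : ℂ)) 2
      (volume.restrict (Metric.ball (0 : Space) s)) := fun i => by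
    refine (hv i).sub (MemLp.of_bound (C := ‖A‖ * s) ?_ ?_)
    · exact (continuous_const.mul (Complex.continuous_ofReal.comp
        (EuclideanSpace.proj i : Space →L[ℝ] ℝ).continuous)).aestronglyMeasurable
    · refine (ae_restrict_iff' measurableSet_ball).2 (.of_forall fun x hx => ?_)
      rw [norm_mul, Complex.norm_real]
      have : ‖x‖ < s := by simpa using hx
      gcongr
      exact (PiLp.norm_apply_le x i).trans this.le
  have h2 : Integrable (fun x : Space => ∑ i, ‖v x i - A * (x i : ℂ)‖ ^ 2)
      (volume.restrict (Metric.ball (0 : Space) s)) :=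
    integrable_finsetSum _ fun i _ => (h1 i).integrable_norm_pow (p := 2) (by norm_num)
  -- The squared norm of B x/|x|³ is |B|²|x|⁻⁴, and the polar weight turns it into ρ⁻², not
  -- integrable at 0.
  have h3 : IntegrableOn (fun x : Space => ‖B‖ ^ 2 * (‖x‖ ^ 4)⁻¹) (Metric.ball (0 : Space) s) := by
    refine h2.congr ?_
    rw [Filter.EventuallyEq, ae_restrict_iff' measurableSet_ball]
    filter_upwards [hlay, ae_ne_zero] with x hx hx0 hxs
    have hle : ‖x‖ ≤ s := le_of_lt (by simpa using hxs)
    have hne : ‖x‖ ≠ 0 := by simpa using hx0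
    have e : ∀ i, ‖v x i - A * (x i : ℂ)‖ ^ 2 = ‖B‖ ^ 2 * (‖x‖ ^ 6)⁻¹ * (x i * x i) := fun i => by
      have : v x i - A * (x i : ℂ) = B * (((‖x‖ ^ 3)⁻¹ : ℝ) : ℂ) * (x i : ℂ) := by
        rw [hx hle]
        simp only [complexify, PiLp.smul_apply, smul_eq_mul]
        ring
      rw [this, norm_mul, norm_mul, Complex.norm_real, Complex.norm_real, mul_pow, mul_pow,
        Real.norm_eq_abs, Real.norm_eq_abs, sq_abs, sq_abs, ← pow_two]
      congr 2
      rw [inv_pow, ← pow_mul]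
    simp only [e]
    rw [← Finset.mul_sum, sum_sq_eq_norm_sq]
    field_simp
  rw [integrableOn_fun_norm_addHaar volume (f := fun ρ : ℝ => ‖B‖ ^ 2 * (ρ ^ 4)⁻¹)] at h3
  have h4 : IntegrableOn (fun ρ : ℝ => ρ ^ (-2 : ℝ)) (Set.Ioo 0 s) := by
    refine (Integrable.const_mul h3 (‖B‖ ^ 2)⁻¹).congr ?_
    rw [Filter.EventuallyEq, ae_restrict_iff' measurableSet_Ioo]
    refine .of_forall fun ρ hρ => ?_
    have hρ0 : ρ ≠ 0 := hρ.1.ne'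
    have hB' : ‖B‖ ≠ 0 := norm_ne_zero_iff.2 hB
    rw [Real.rpow_neg hρ.1.le, Real.rpow_two]
    simp
    field_simp
  rw [intervalIntegral.integrableOn_Ioo_rpow_iff hs] at h4
  norm_num at h4

/-- The growing mode at infinity is determined by the decay condition. -/
theorem eq_zero_of_decay {w : Space → Displacement} {R : ℝ} {A B : ℂ}
    (hO : w =O[cocompact Space] fun x => (‖x‖ ^ 2)⁻¹)
    (hlay : ∀ᵐ x : Space, R < ‖x‖ →
      w x = (A + B * (((‖x‖ ^ 3)⁻¹ : ℝ) : ℂ)) • complexify x) : A = 0 := by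
  by_contra hA
  obtain ⟨C, hC⟩ := hO.bound
  rw [← Metric.cobounded_eq_cocompact, (hasBasis_cobounded_norm (E := Space)).eventually_iff] at hC
  obtain ⟨S, -, hS⟩ := hC
  have hA' : 0 < ‖A‖ := norm_pos_iff.2 hA
  -- Beyond R and S both the mode formula and the decay bound hold; they give |A||x|³ ≤ C + |B|,
  -- which fails once |x| exceeds 1 and (C + |B|)/|A|.
  set T := max (max R S) (max 1 ((C + ‖B‖) / ‖A‖)) with hT
  have hopen : IsOpen {x : Space | T < ‖x‖} := isOpen_lt continuous_const continuous_norm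
  have hTne : {x : Space | T < ‖x‖}.Nonempty := by
    obtain ⟨x, hx⟩ := NormedSpace.exists_lt_norm ℝ Space T
    exact ⟨x, hx⟩
  obtain ⟨x, hxT, hx⟩ := (Measure.dense_of_ae hlay).inter_open_nonempty _ hopen hTne
  simp only [Set.mem_ofPred_eq] at hxT hx
  have hR : R < ‖x‖ := lt_of_le_of_lt ((le_max_left _ _).trans (le_max_left _ _)) hxT
  have hS' : S ≤ ‖x‖ := ((le_max_right _ _).trans (le_max_left _ _)).trans hxT.le
  have h1 : 1 < ‖x‖ := lt_of_le_of_lt ((le_max_left _ _).trans (le_max_right _ _)) hxT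
  have h2 : (C + ‖B‖) / ‖A‖ < ‖x‖ :=
    lt_of_le_of_lt ((le_max_right _ _).trans (le_max_right _ _)) hxT
  have hx0 : 0 < ‖x‖ := by linarith
  have hbound := hS hS'
  rw [hx hR, norm_smul, norm_complexify, Real.norm_of_nonneg (by positivity)] at hbound
  have h3 : ‖A‖ - ‖B‖ * (‖x‖ ^ 3)⁻¹ ≤ ‖A + B * (((‖x‖ ^ 3)⁻¹ : ℝ) : ℂ)‖ := by
    have := norm_sub_le (A + B * (((‖x‖ ^ 3)⁻¹ : ℝ) : ℂ)) (B * (((‖x‖ ^ 3)⁻¹ : ℝ) : ℂ))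
    rw [add_sub_cancel_right, norm_mul B, Complex.norm_real,
      Real.norm_of_nonneg (by positivity)] at this
    linarith
  have h4 : (‖A‖ - ‖B‖ * (‖x‖ ^ 3)⁻¹) * ‖x‖ ≤ C * (‖x‖ ^ 2)⁻¹ :=
    (mul_le_mul_of_nonneg_right h3 hx0.le).trans hbound
  have h5 : ‖A‖ * ‖x‖ ^ 3 ≤ C + ‖B‖ := by
    have := mul_le_mul_of_nonneg_right h4 (by positivity : 0 ≤ ‖x‖ ^ 2)
    have e1 : (‖A‖ - ‖B‖ * (‖x‖ ^ 3)⁻¹) * ‖x‖ * ‖x‖ ^ 2 = ‖A‖ * ‖x‖ ^ 3 - ‖B‖ := by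
      field_simp
    have e2 : C * (‖x‖ ^ 2)⁻¹ * ‖x‖ ^ 2 = C := by field_simp
    linarith
  rw [div_lt_iff₀ hA'] at h2
  have h6 : ‖x‖ ≤ ‖x‖ ^ 3 := le_self_pow₀ h1.le (by norm_num)
  nlinarith

/-! ### Uniqueness of the coefficients. -/

section Uniqueness

variable {N : ℕ} {r : ℕ → ℝ} {lam mu : ℝ} {ε a b a' b' : ℕ → ℂ}

/-- The coefficients in the layers are determined by the transmission conditions. -/
theorem coeff_unique (h : IsRadii N r) (hconv : 0 < 3 * lam + 2 * mu)
    (hε : ∀ i < N, ε i ≠ ε (i + 1)) (hP : IsUnit (momentumMatrix N r lam mu ε))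
    (h0 : a 0 = a' 0) (hb : b N = 0) (hb' : b' N = 0)
    (hd : ∀ i < N, fieldDefect r a b i = 0) (hd' : ∀ i < N, fieldDefect r a' b' i = 0)
    (ht : ∀ i < N, tractionDefect r lam mu ε a b i = 0)
    (ht' : ∀ i < N, tractionDefect r lam mu ε a' b' i = 0) {j : ℕ} (hj : j ≤ N) :
    a j = a' j ∧ b j = b' j := by
  rw [forall_tractionDefect_eq_zero_iff h hconv hε hb hd] at ht
  rw [forall_tractionDefect_eq_zero_iff h hconv hε hb' hd', ← h0] at ht'
  have hinj : Function.Injective (momentumMatrix N r lam mu ε)ᵀ.mulVec :=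
    Matrix.mulVec_injective_iff_isUnit.2 ((Matrix.isUnit_transpose _).2 hP)
  have hjump : ∀ i < N, coulombJump r b i = coulombJump r b' i := fun i hi =>
    congrFun (hinj (ht.trans ht'.symm)) ⟨i, hi⟩
  refine ⟨?_, ?_⟩
  · rw [eq_add_sum_of_fieldDefect hd hj, eq_add_sum_of_fieldDefect hd' hj, h0]
    congr 1
    exact Finset.sum_congr rfl fun i hi => hjump i (by have := Finset.mem_range.1 hi; omega)
  · rw [eq_sum_coulombJump h hb hj, eq_sum_coulombJump h hb' hj]
    exact Finset.sum_congr rfl fun i hi => by rw [hjump i (Finset.mem_Ico.1 hi).2]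

/-- A spherically symmetric solution has the layered form almost everywhere. -/
theorem IsRadii.exists_coeff_of_isSphericallySymmetric (h : IsRadii N r) (hmu : 0 < mu)
    (hconv : 0 < 3 * lam + 2 * mu) (hε : ∀ j ≤ N, ε j ≠ 0) {a₀ : ℂ} {v : Space → Displacement}
    (hv : IsLameSolution N r lam mu ε (background lam mu a₀) v) (hs : IsSphericallySymmetric v) :
    ∃ a b : ℕ → ℂ, a 0 = a₀ ∧ b N = 0 ∧ ∀ᵐ x, ∀ j ≤ N, x ∈ layer N r j →
      v x = (modeConst lam mu * (a j + b j * (((‖x‖ ^ 3)⁻¹ : ℝ) : ℂ))) • complexify x := by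
  obtain ⟨⟨G, hG, heq⟩, hO⟩ := hv
  obtain ⟨f, hf⟩ := hs
  have hc0 := modeConst_ne_zero hmu hconv
  have hmode : ∀ j, ∃ A B : ℂ, j ≤ N → ∀ᵐ x : Space, x ∈ layer N r j →
      v x = (A + B * (((‖x‖ ^ 3)⁻¹ : ℝ) : ℂ)) • complexify x := by
    intro j
    by_cases hj : j ≤ N
    -- Here λ + 2μ > 0 follows from 3λ + 6μ > 0.
    · obtain ⟨A, B, hAB⟩ := h.exists_modes hj (hε j hj) (by linarith) hG heq hf
      exact ⟨A, B, fun _ => hAB⟩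
    · exact ⟨0, 0, fun hle => absurd hle hj⟩
  choose A B hAB using hmode
  refine ⟨fun j => A j / modeConst lam mu, fun j => B j / modeConst lam mu, ?_, ?_, ?_⟩
  · have hfar : ∀ᵐ x : Space, r 1 < ‖x‖ → v x - background lam mu a₀ x =
        ((A 0 - modeConst lam mu * a₀) + B 0 * (((‖x‖ ^ 3)⁻¹ : ℝ) : ℂ)) • complexify x := by
      filter_upwards [hAB 0 (Nat.zero_le _)] with x hx hr
      rw [hx (by simpa [layer] using hr), background_eq]
      module
    have := eq_zero_of_decay hO hfar
    rw [div_eq_iff hc0]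
    linear_combination this
  · have hN := h.one_le
    have hcore : ∀ᵐ x : Space, ‖x‖ ≤ r N →
        v x = (A N + B N * (((‖x‖ ^ 3)⁻¹ : ℝ) : ℂ)) • complexify x := by
      filter_upwards [hAB N le_rfl] with x hx hr
      refine hx ?_
      have : N ≠ 0 := by omega
      simpa [layer, this] using hr
    have hB : B N = 0 := decay_eq_zero_of_memLp (h.pos N hN le_rfl) (fun i =>
      (hG.memLp_field _ (isCompact_closedBall (0 : Space) (r N)) i).mono_measure
        (Measure.restrict_mono Metric.ball_subset_closedBall le_rfl)) hcore
    simp [hB]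
  · have : ∀ᵐ x : Space, ∀ j ∈ Finset.range (N + 1), x ∈ layer N r j →
        v x = (A j + B j * (((‖x‖ ^ 3)⁻¹ : ℝ) : ℂ)) • complexify x := by
      rw [eventually_all_finset]
      exact fun j hj => hAB j (by have := Finset.mem_range.1 hj; omega)
    filter_upwards [this] with x hx j hj hxj
    rw [hx j (Finset.mem_range.2 (by omega)) hxj]
    congr 1
    field_simp

end Uniqueness

/-! ### The solution of the linear system and the conclusion. -/

/-- The jumps solving the transmission system. -/
def solutionJump (N : ℕ) (r : ℕ → ℝ) (lam mu : ℝ) (ε : ℕ → ℂ) (a₀ : ℂ) (i : ℕ) : ℂ :=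
  if h : i < N then a₀ * (((momentumMatrix N r lam mu ε)ᵀ)⁻¹ *ᵥ onesVec N) ⟨i, h⟩ else 0

theorem decayCoeff_solutionJump_zero (N : ℕ) (r : ℕ → ℝ) (lam mu : ℝ) (ε : ℕ → ℂ) (a₀ : ℂ) :
    decayCoeff N r (solutionJump N r lam mu ε a₀) 0 = a₀ * (onesVec N ⬝ᵥ (upsilon N r *ᵥ
      (((momentumMatrix N r lam mu ε)ᵀ)⁻¹ *ᵥ onesVec N))) := by
  rw [decayCoeff, Nat.Ico_zero_eq_range, ← Fin.sum_univ_eq_sum_range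
    fun i => solutionJump N r lam mu ε a₀ i * (r (i + 1) : ℂ) ^ 3]
  simp only [dotProduct, onesVec, one_mul, upsilon, Matrix.mulVec_diagonal, Finset.mul_sum]
  refine Finset.sum_congr rfl fun i _ => ?_
  simp only [solutionJump, i.2, dif_pos]
  push_cast
  ring

theorem mulVec_solutionJump {N : ℕ} {r : ℕ → ℝ} {lam mu : ℝ} {ε : ℕ → ℂ} (a₀ : ℂ)
    (hP : IsUnit (momentumMatrix N r lam mu ε)) :
    (momentumMatrix N r lam mu ε)ᵀ *ᵥ (fun i : Fin N => solutionJump N r lam mu ε a₀ i) =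
      a₀ • onesVec N := by
  have h1 : (fun i : Fin N => solutionJump N r lam mu ε a₀ i) =
      a₀ • (((momentumMatrix N r lam mu ε)ᵀ)⁻¹ *ᵥ onesVec N) := by
    ext i
    simp [solutionJump]
  have h2 : IsUnit ((momentumMatrix N r lam mu ε)ᵀ).det := by
    rw [Matrix.det_transpose]
    exact (Matrix.isUnit_iff_isUnit_det _).1 hP
  rw [h1, Matrix.mulVec_smul, Matrix.mulVec_mulVec, Matrix.mul_nonsing_inv _ h2, Matrix.one_mulVec]

end LameLayers

end

theorem mainTheorem3 (N : ℕ) (hN : 1 ≤ N) (r : ℕ → ℝ)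
    (hr_pos : ∀ j, 1 ≤ j → j ≤ N → 0 < r j)
    (hr_anti : ∀ j, 1 ≤ j → j < N → r (j + 1) < r j)
    (lam mu : ℝ) (hmu : 0 < mu) (hconv : 0 < 3 * lam + 2 * mu)
    (ε : ℕ → ℂ) (hε₀ : 0 < (ε 0).re ∧ (ε 0).im = 0)
    (hε_im : ∀ j, 1 ≤ j → j ≤ N → 0 ≤ (ε j).im)
    (hε_ne : ∀ j, 1 ≤ j → j ≤ N → ε (j - 1) ≠ ε j)
    (a₀ : ℂ)
    (hP : IsUnit (LameLayers.momentumMatrix N r lam mu ε)) :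
    ∃ u : LameLayers.Space → LameLayers.Displacement,
      LameLayers.IsLameSolution N r lam mu ε (LameLayers.background lam mu a₀) u ∧
      LameLayers.HasLayeredForm N r lam mu a₀ u ∧
      (∀ x : LameLayers.Space, r 1 < ‖x‖ →
        u x - LameLayers.background lam mu a₀ x =
          ((((‖x‖ ^ 3)⁻¹ : ℝ) : ℂ) *
            (LameLayers.onesVec N ⬝ᵥ (LameLayers.upsilon N r *ᵥ
              (((LameLayers.momentumMatrix N r lam mu ε)ᵀ)⁻¹ *ᵥ LameLayers.onesVec N)))) •
            LameLayers.background lam mu a₀ x) ∧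
      (∀ v : LameLayers.Space → LameLayers.Displacement,
        LameLayers.IsLameSolution N r lam mu ε (LameLayers.background lam mu a₀) v →
        LameLayers.HasLayeredForm N r lam mu a₀ v → v = u) ∧
      ((∀ j, 1 ≤ j → j ≤ N → ε j ≠ 0) →
        ∀ v : LameLayers.Space → LameLayers.Displacement,
          LameLayers.IsLameSolution N r lam mu ε (LameLayers.background lam mu a₀) v →
          LameLayers.IsSphericallySymmetric v → v =ᵐ[volume] u) := by
  open LameLayers in
  have h : IsRadii N r := ⟨hN, hr_pos, hr_anti⟩
  have hε : ∀ i < N, ε i ≠ ε (i + 1) := fun i hi => by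
    simpa using hε_ne (i + 1) (by omega) (by omega)
  set c := modeConst lam mu with hc
  have hc0 : c ≠ 0 := modeConst_ne_zero hmu hconv
  set p := solutionJump N r lam mu ε a₀ with hp
  set a := linearCoeff a₀ p with ha
  set b := decayCoeff N r p with hb
  have ha0 : a 0 = a₀ := by simp [ha, linearCoeff]
  have hbN : b N = 0 := by simp [hb, decayCoeff]
  have hd : ∀ i < N, fieldDefect r a b i = 0 := fun i hi => fieldDefect_coeff h hi
  have ht : ∀ i < N, tractionDefect r lam mu ε a b i = 0 := by
    rw [forall_tractionDefect_eq_zero_iff h hconv hε hbN hd, ha0, ← mulVec_solutionJump a₀ hP]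
    congr 1
    ext i
    exact coulombJump_decayCoeff h i.2
  have hform : ∀ j ≤ N, ∀ x ∈ layer N r j,
      c • layeredField N r (a 0) (coulombJump r b) x =
        (a j + b j * (((‖x‖ ^ 3)⁻¹ : ℝ) : ℂ)) • uniformMode lam mu x :=
    fun j hj x hx => h.smul_layeredField_eq hbN hd hj hx
  have hsol : IsLameSolution N r lam mu ε (background lam mu a₀)
      fun x => c • layeredField N r (a 0) (coulombJump r b) x := by
    simpa only [ha0] using h.isLameSolution_layered hbN hd ht
  refine ⟨fun x => c • layeredField N r (a 0) (coulombJump r b) x, hsol,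
    ⟨a, b, ha0, hbN, hform⟩, ?_, ?_, ?_⟩
  · intro x hx
    beta_reduce
    rw [hform 0 (Nat.zero_le _) x (by simpa [layer] using hx), ha0, hb,
      decayCoeff_solutionJump_zero, background]
    module
  · rintro v ⟨⟨G, hG, heq⟩, -⟩ ⟨a', b', ha', hb', hv⟩
    obtain ⟨hd', ht'⟩ := h.transmission hb' hc0 hG heq (.of_forall fun x j hj hx => by
      rw [hv j hj x hx, uniformMode_eq, smul_smul, mul_comm])
    ext1 x
    obtain ⟨j, hj, hx⟩ := h.exists_mem_layer x
    obtain ⟨e1, e2⟩ := coeff_unique h hconv hε hP (ha0.trans ha'.symm) hbN hb' hd hd' ht ht' hj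
    rw [hv j hj x hx, hform j hj x hx, e1, e2]
  · intro hε0 v hv hs
    -- The exterior value ε₀ is nonzero because its real part is positive; the extra assumption only
    -- covers the inner layers.
    have hne : ∀ j ≤ N, ε j ≠ 0 := fun j hj => by
      rcases Nat.eq_zero_or_pos j with rfl | hpos
      · intro h0
        simp [h0] at hε₀
      · exact hε0 j hpos hj
    obtain ⟨a', b', ha', hb', hv'⟩ :=
      h.exists_coeff_of_isSphericallySymmetric hmu hconv hne hv hs
    obtain ⟨⟨G, hG, heq⟩, -⟩ := hv
    obtain ⟨hd', ht'⟩ := h.transmission hb' hc0 hG heq hv'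
    filter_upwards [hv'] with x hx
    obtain ⟨j, hj, hxj⟩ := h.exists_mem_layer x
    obtain ⟨e1, e2⟩ := coeff_unique h hconv hε hP (ha0.trans ha'.symm) hbN hb' hd hd' ht ht' hj
    rw [hx j hj hxj, hform j hj x hxj, e1, e2, uniformMode_eq, smul_smul, mul_comm]
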